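/- Let $N\ge 1$, let $1<p_1,\dots,p_N<\infty$ and let $1\le p<\infty$. Here $\ell_q$ denotes the complex Banach space of $q$-summable sequences, and $\ell_{p_1}\hat\otimes\cdots\hat\otimes\ell_{p_N}$ denotes the projective tensor product, i.e. the completion of the algebraic tensor product $\ell_{p_1}\otimes\cdots\otimes\ell_{p_N}$ in the norm $\|u\|=\inf\sum_j\prod_{i=1}^N\|x_{j,i}\|$, the infimum being over all finite representations $u=\sum_j x_{j,1}\otimes\cdots\otimes x_{j,N}$. For nonempty $A\subseteq\{1,\dots,N\}$ let $r_A\in[1,\infty)$ be given by $\frac1{r_A}=\min\bigl\{1,\sum_{i\in A}\frac1{p_i}\bigr\}$. Then $\ell_p$ embeds isomorphically into $\ell_{p_1}\hat\otimes\cdots\hat\otimes\ell_{p_N}$ (that is, there are a bounded linear map $T:\ell_p\to\ell_{p_1}\hat\otimes\cdots\hat\otimes\ell_{p_N}$ and a constant $c>0$ with $\|Tx\|\ge c\|x\|$ for all $x\in\ell_p$) if and only if there exists a nonempty $A\subseteq\{1,\dots,N\}$ such that $p=r_A$. -/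

import Mathlib

open scoped ENNReal TensorProduct

/-- The complex Banach space `ℓ_p` of `p`-summable sequences. -/
abbrev Ell (p : ℝ≥0∞) : Type := lp (fun _ : ℕ => ℂ) p

/-- The projective tensor product `ℓ_{p 1} ⊗̂ ⋯ ⊗̂ ℓ_{p N}`: the completion of the algebraic tensor
product for its Mathlib norm, which is the projective one, that is, the infimum of
`∑ j, ‖c j‖ * ∏ i, ‖x j i‖` over all finite representations `∑ j, c j • ⨂ₜ i, x j i`. -/
abbrev ProjectiveTensorEll {N : ℕ} (p : Fin N → ℝ≥0∞) [∀ i, Fact (1 ≤ p i)] : Type :=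
  UniformSpace.Completion (⨂[ℂ] i, Ell (p i))

/-- `X` embeds isomorphically into `Y`: there is a bounded linear map from `X` to `Y` that is
bounded below, i.e. an isomorphism of `X` onto its range. -/
def EmbedsIsomorphically (X Y : Type*) [NormedAddCommGroup X] [NormedSpace ℂ X]
    [NormedAddCommGroup Y] [NormedSpace ℂ Y] : Prop :=
  ∃ T : X →L[ℂ] Y, ∃ c : ℝ, 0 < c ∧ ∀ x : X, c * ‖x‖ ≤ ‖T x‖

/-- The exponent `r_A` given by `1 / r_A = min {1, ∑ i ∈ A, 1 / p i}`. The inverse is that of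
`ℝ≥0∞`, an involution. -/
noncomputable def rExponent {N : ℕ} (p : Fin N → ℝ≥0∞) (A : Finset (Fin N)) : ℝ≥0∞ :=
  (min 1 (∑ i ∈ A, (p i)⁻¹))⁻¹

/-!
The model for the copies of `ℓ_r` is the diagonal. Fix a nonempty set `A` of factors, let
`r = r_A`, and let `I 1, I 2, …` be disjoint sets of integers. Tensors `w k` whose coefficients
live on the slabs `I k × ⋯ × I k` in the directions of `A`, all other indices being fixed, behave
like disjoint vectors of `ℓ_r`: up to a factor `2`, `‖∑ w k‖ = (∑ ‖w k‖ ^ r) ^ (1 / r)`.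
The lower estimate (`sum_norm_rpow_le_of_slab`) is Hölder's inequality for the multilinear map that
cuts an elementary tensor into its slabs. For the upper estimate (`norm_sum_le_of_slab`) duality
reduces the claim to elementary tensors; for these, the identity
`⊗ a + ⊗ b = (1 / n) ∑ ⊗ (a + ζ b)`, the sum being over the `n`-th roots of unity and `n = #A`,
bounds a sum of diagonal tensors by one product of norms. Applied to
`e_k ⊗ ⋯ ⊗ e_k`, the two estimates embed `ℓ_r`.

Conversely, perturb an embedding of `ℓ_s` so that the unit vectors go to tensors with finitely many
coefficients, and let `A` be minimal such that some block subspace of `ℓ_s` embeds into tensors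
with the indices outside `A` fixed. A slice that fixes one more index, from `A`, is then not bounded
below on any block subspace, so that finitely many slices can be made small on a common one
(`exists_isBlockMap_small`). A gliding hump therefore produces normalized blocks of `ℓ_s` whose
images are close to tensors `w k` as above. Sums of `K` of them have norm comparable both with
`K ^ (1 / s)` and with `K ^ (1 / r_A)`, whence `s = r_A` (`eq_rExponent_of_slices_small`). The set
`A` is not empty because the tensors with all indices fixed form a line.

All estimates take place on the algebraic tensor product and on the finitely
supported sequences; the passage to the completions uses only density.
-/

namespace EllTensor

/-! ### Coordinate restrictions on `ℓ_q` -/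

theorem one_le_toReal (q : ℝ≥0∞) [hq : Fact (1 ≤ q)] (hq' : q < ∞) : 1 ≤ q.toReal := by
  simpa using (ENNReal.toReal_le_toReal ENNReal.one_ne_top hq'.ne).2 hq.out

theorem toReal_pos (q : ℝ≥0∞) [Fact (1 ≤ q)] (hq' : q < ∞) : 0 < q.toReal :=
  zero_lt_one.trans_le (one_le_toReal q hq')

open Classical in
/-- The contractive projection of `ℓ_q` onto the sequences vanishing off `S`. -/
noncomputable def restrictL (q : ℝ≥0∞) [Fact (1 ≤ q)] (S : Set ℕ) : Ell q →L[ℂ] Ell q :=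
  LinearMap.mkContinuous
    { toFun := fun x => ⟨fun n => if n ∈ S then x n else 0, (lp.memℓp x).mono'
        (fun n => by split_ifs <;> simp)⟩
      map_add' := fun x y => by
        ext n
        change (if n ∈ S then (x + y) n else 0)
          = (if n ∈ S then x n else 0) + (if n ∈ S then y n else 0)
        by_cases h : n ∈ S <;> simp [h]
      map_smul' := fun c x => by
        ext n
        by_cases h : n ∈ S <;> simp [h] }
    1
    (fun x => by
      rw [one_mul]
      refine lp.norm_mono (zero_lt_one.trans_le Fact.out).ne' (fun n => ?_)
      by_cases h : n ∈ S <;> simp [h])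

section

variable {q : ℝ≥0∞} [Fact (1 ≤ q)]

open Classical in
theorem restrictL_apply (S : Set ℕ) (x : Ell q) (n : ℕ) :
    restrictL q S x n = if n ∈ S then x n else 0 := rfl

theorem norm_restrictL_le (S : Set ℕ) : ‖restrictL q S‖ ≤ 1 :=
  LinearMap.mkContinuous_norm_le _ zero_le_one _

theorem norm_restrictL_apply_le (S : Set ℕ) (x : Ell q) : ‖restrictL q S x‖ ≤ ‖x‖ := by
  simpa using (restrictL q S).le_of_opNorm_le (norm_restrictL_le S) x

theorem restrictL_mul (S T : Set ℕ) :
    restrictL q S * restrictL q T = restrictL q (S ∩ T) := by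
  ext x n
  by_cases h : n ∈ S <;> by_cases h' : n ∈ T <;> simp [restrictL_apply, h, h']

theorem restrictL_univ : restrictL q Set.univ = 1 := by
  ext x n
  simp [restrictL_apply]

theorem restrictL_union {S T : Set ℕ} (h : Disjoint S T) :
    restrictL q (S ∪ T) = restrictL q S + restrictL q T := by
  ext x n
  by_cases hS : n ∈ S
  · simp [restrictL_apply, hS, Set.disjoint_left.1 h hS]
  · by_cases hT : n ∈ T
    · simp [restrictL_apply, hS, hT, Set.mem_union_right S hT]
    · simp [restrictL_apply, hS, hT, show n ∉ S ∪ T from fun h => h.elim hS hT]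

theorem restrictL_singleton (m : ℕ) (x : Ell q) :
    restrictL q {m} x = (x m) • (lp.single q m (1 : ℂ) : Ell q) := by
  ext n
  by_cases h : n = m
  · subst h; simp [restrictL_apply]
  · simp [restrictL_apply, h]

theorem tendsto_restrictL_Iio (hq : q < ∞) (x : Ell q) :
    Filter.Tendsto (fun m : ℕ => restrictL q (Set.Iio m) x) Filter.atTop (nhds x) := by
  refine (lp.hasSum_single hq.ne x).tendsto_sum_nat.congr (fun m => ?_)
  ext n
  rw [lp.coeFn_sum, Finset.sum_apply]
  by_cases h : n < m <;> simp [restrictL_apply, Pi.single_apply, h]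

theorem norm_add_rpow (hq : q < ∞) {x y : Ell q} (h : ∀ n, x n = 0 ∨ y n = 0) :
    ‖x + y‖ ^ q.toReal = ‖x‖ ^ q.toReal + ‖y‖ ^ q.toReal := by
  have hq0 := toReal_pos q hq
  refine (lp.hasSum_norm hq0 (x + y)).unique ?_
  refine ((lp.hasSum_norm hq0 x).add (lp.hasSum_norm hq0 y)).congr_fun ?_
  intro n
  rcases h n with h | h <;> simp [h, Real.zero_rpow hq0.ne']

theorem sum_norm_restrictL_rpow_le (hq : q < ∞) (T : Finset ℕ) (I : ℕ → Set ℕ)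
    (hI : (T : Set ℕ).PairwiseDisjoint I) (x : Ell q) :
    ∑ k ∈ T, ‖restrictL q (I k) x‖ ^ q.toReal ≤ ‖x‖ ^ q.toReal := by
  have key : ∑ k ∈ T, ‖restrictL q (I k) x‖ ^ q.toReal
      = ‖restrictL q (⋃ k ∈ T, I k) x‖ ^ q.toReal := by
    induction T using Finset.induction_on with
    | empty =>
      have : restrictL q ∅ x = 0 := by ext n; simp [restrictL_apply]
      simp [this, Real.zero_rpow (toReal_pos q hq).ne']
    | insert a T ha ih =>
      have hd : Disjoint (I a) (⋃ k ∈ T, I k) := by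
        rw [Set.disjoint_iUnion₂_right]
        intro k hk
        exact hI (by simp) (by simp [hk]) (fun h => ha (h ▸ hk))
      rw [Finset.sum_insert ha, ih (hI.subset (by simp)), Finset.set_biUnion_insert,
        restrictL_union hd, add_apply, norm_add_rpow hq]
      intro n
      by_cases hn : n ∈ I a
      · right
        have hn' := Set.disjoint_left.1 hd hn
        simp only [restrictL_apply, if_neg hn']
      · left
        simp only [restrictL_apply, if_neg hn]
  rw [key]
  exact Real.rpow_le_rpow (norm_nonneg _) (norm_restrictL_apply_le _ _) (toReal_pos q hq).le

end

/-! ### Finitely supported sequences in `ℓ_q` -/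

/-- The inclusion of the finitely supported sequences into `ℓ_q`. -/
noncomputable def ofFinsupp (q : ℝ≥0∞) : (ℕ →₀ ℂ) →ₗ[ℂ] Ell q :=
  Finsupp.linearCombination ℂ (fun n => (lp.single q n (1 : ℂ) : Ell q))

@[simp]
theorem ofFinsupp_apply {q : ℝ≥0∞} (a : ℕ →₀ ℂ) (n : ℕ) : ofFinsupp q a n = a n := by
  simp only [ofFinsupp, Finsupp.linearCombination_apply, Finsupp.sum, lp.coeFn_sum,
    Finset.sum_apply, lp.coeFn_smul, Pi.smul_apply, lp.coeFn_single, smul_eq_mul]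
  rw [Finset.sum_eq_single n]
  · simp
  · intro b _ hb
    simp [hb.symm]
  · simp

theorem ofFinsupp_single {q : ℝ≥0∞} (n : ℕ) (c : ℂ) :
    ofFinsupp q (Finsupp.single n c) = c • (lp.single q n (1 : ℂ) : Ell q) := by
  simp [ofFinsupp]

theorem ofFinsupp_injective {q : ℝ≥0∞} : Function.Injective (ofFinsupp q) := by
  intro a b h
  ext n
  rw [← ofFinsupp_apply (q := q) a n, h, ofFinsupp_apply]

section

variable {q : ℝ≥0∞} [Fact (1 ≤ q)]

theorem norm_ofFinsupp_single (n : ℕ) : ‖ofFinsupp q (Finsupp.single n 1)‖ = 1 := by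
  rw [ofFinsupp_single, one_smul, lp.norm_single (zero_lt_one.trans_le Fact.out)]
  simp

theorem norm_coeff_le (a : ℕ →₀ ℂ) (n : ℕ) : ‖a n‖ ≤ ‖ofFinsupp q a‖ := by
  have := lp.norm_apply_le_norm (zero_lt_one.trans_le (Fact.out : 1 ≤ q)).ne' (ofFinsupp q a) n
  rwa [ofFinsupp_apply] at this

theorem denseRange_ofFinsupp (hq : q < ∞) : DenseRange (ofFinsupp q) := by
  intro x
  refine mem_closure_of_tendsto (lp.hasSum_single hq.ne x).tendsto_sum_nat
    (Filter.Eventually.of_forall fun m => ⟨∑ n ∈ Finset.range m, Finsupp.single n (x n), ?_⟩)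
  rw [map_sum]
  refine Finset.sum_congr rfl fun n _ => ?_
  rw [ofFinsupp_single, ← lp.single_smul]
  simp

theorem norm_ofFinsupp_rpow (hq : q < ∞) (a : ℕ →₀ ℂ) :
    ‖ofFinsupp q a‖ ^ q.toReal = ∑ n ∈ a.support, ‖a n‖ ^ q.toReal := by
  have hq0 := toReal_pos q hq
  refine (lp.hasSum_norm hq0 _).unique ?_
  simp only [ofFinsupp_apply]
  refine hasSum_sum_of_ne_finset_zero fun n hn => ?_
  rw [Finsupp.notMem_support_iff.1 hn, norm_zero, Real.zero_rpow hq0.ne']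

end

/-! ### Rectangle projections on the algebraic tensor product -/

section

variable {N : ℕ} {p : Fin N → ℝ≥0∞} [∀ i, Fact (1 ≤ p i)]

variable (p) in
/-- The projection of the algebraic tensor product, with its projective norm, onto the tensors
whose coefficients `u (n 1, …, n N)` vanish off the rectangle `S 1 × ⋯ × S N`. -/
noncomputable def rect (S : Fin N → Set ℕ) :
    (⨂[ℂ] i, Ell (p i)) →L[ℂ] (⨂[ℂ] i, Ell (p i)) :=
  PiTensorProduct.mapL fun i => restrictL (p i) (S i)

theorem rect_tprod (S : Fin N → Set ℕ) (x : ∀ i, Ell (p i)) :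
    rect p S (PiTensorProduct.tprod ℂ x)
      = PiTensorProduct.tprod ℂ fun i => restrictL (p i) (S i) (x i) := by
  simp [rect]

theorem rect_rect (S T : Fin N → Set ℕ) (v : ⨂[ℂ] i, Ell (p i)) :
    rect p S (rect p T v) = rect p (fun i => S i ∩ T i) v := by
  have := congrArg (fun f => f v)
    (PiTensorProduct.mapL_mul (fun i => restrictL (p i) (S i)) fun i => restrictL (p i) (T i))
  simp only [restrictL_mul] at this
  exact this.symm

theorem rect_rect_of_subset {S T : Fin N → Set ℕ} (h : ∀ i, T i ⊆ S i)
    (v : ⨂[ℂ] i, Ell (p i)) : rect p S (rect p T v) = rect p T v := by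
  rw [rect_rect]
  congr 2
  funext i
  exact Set.inter_eq_right.2 (h i)

theorem rect_univ (v : ⨂[ℂ] i, Ell (p i)) : rect p (fun _ => Set.univ) v = v := by
  simp only [rect, restrictL_univ, PiTensorProduct.mapL_one]
  rfl

theorem norm_rect_apply_le (S : Fin N → Set ℕ) (v : ⨂[ℂ] i, Ell (p i)) :
    ‖rect p S v‖ ≤ ‖v‖ := by
  have h : ‖rect p S‖ ≤ 1 := (PiTensorProduct.opNorm_mapL _).trans
    (Finset.prod_le_one (fun _ _ => norm_nonneg _) fun i _ => norm_restrictL_le (S i))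
  simpa using (rect p S).le_of_opNorm_le h v

theorem rect_update_union (S : Fin N → Set ℕ) (j : Fin N) {s t : Set ℕ} (h : Disjoint s t)
    (v : ⨂[ℂ] i, Ell (p i)) :
    rect p (Function.update S j (s ∪ t)) v
      = rect p (Function.update S j s) v + rect p (Function.update S j t) v := by
  have hu : ∀ s : Set ℕ, rect p (Function.update S j s)
      = PiTensorProduct.mapLMultilinear ℂ (fun i => Ell (p i)) (fun i => Ell (p i))
          (Function.update (fun i => restrictL (p i) (S i)) j (restrictL (p j) s)) := by
    intro s
    change PiTensorProduct.mapL _ = PiTensorProduct.mapL _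
    congr 1
    funext i
    rcases eq_or_ne i j with rfl | hi
    · simp
    · simp [hi]
  rw [hu, hu, hu, restrictL_union h, ContinuousMultilinearMap.map_update_add, add_apply]

/-- The tensors all of whose coefficients are zero outside a finite cube `{0, …, m - 1} ^ N`,
encoded as the tensors fixed by the projections onto all larger cubes. -/
def IsFinite (v : ⨂[ℂ] i, Ell (p i)) : Prop :=
  ∃ m : ℕ, ∀ m', m ≤ m' → rect p (fun _ => Set.Iio m') v = v

theorem isFinite_rect_Iio (m : ℕ) (v : ⨂[ℂ] i, Ell (p i)) :
    IsFinite (rect p (fun _ => Set.Iio m) v) :=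
  ⟨m, fun _ h => rect_rect_of_subset (fun _ => Set.Iio_subset_Iio h) v⟩

theorem IsFinite.add {v w : ⨂[ℂ] i, Ell (p i)} (hv : IsFinite v) (hw : IsFinite w) :
    IsFinite (v + w) := by
  obtain ⟨m, hm⟩ := hv
  obtain ⟨n, hn⟩ := hw
  refine ⟨max m n, fun k hk => ?_⟩
  rw [map_add, hm k ((le_max_left _ _).trans hk), hn k ((le_max_right _ _).trans hk)]

theorem IsFinite.smul {v : ⨂[ℂ] i, Ell (p i)} (hv : IsFinite v) (c : ℂ) :
    IsFinite (c • v) := by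
  obtain ⟨m, hm⟩ := hv
  exact ⟨m, fun k hk => by rw [map_smul, hm k hk]⟩

theorem IsFinite.rect {v : ⨂[ℂ] i, Ell (p i)} (hv : IsFinite v) (S : Fin N → Set ℕ) :
    IsFinite (rect p S v) := by
  obtain ⟨m, hm⟩ := hv
  refine ⟨m, fun k hk => ?_⟩
  conv_rhs => rw [← hm k hk]
  simp only [rect_rect, Set.inter_comm]

theorem isFinite_linearCombination {y : ℕ → ⨂[ℂ] i, Ell (p i)} (hy : ∀ n, IsFinite (y n))
    (a : ℕ →₀ ℂ) : IsFinite (Finsupp.linearCombination ℂ y a) := by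
  induction a using Finsupp.induction_linear with
  | zero => exact ⟨0, fun _ _ => by simp⟩
  | add a b ha hb => rw [map_add]; exact ha.add hb
  | single n c => rw [Finsupp.linearCombination_single]; exact (hy n).smul c

theorem tendsto_rect_Iio (hp : ∀ i, p i < ∞) (v : ⨂[ℂ] i, Ell (p i)) :
    Filter.Tendsto (fun m : ℕ => rect p (fun _ => Set.Iio m) v) Filter.atTop (nhds v) := by
  induction v using PiTensorProduct.induction_on with
  | smul_tprod c x =>
    simp only [map_smul, rect_tprod]
    refine Filter.Tendsto.const_smul ?_ c
    have h : Filter.Tendsto (fun m : ℕ => fun i => restrictL (p i) (Set.Iio m) (x i))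
        Filter.atTop (nhds x) :=
      tendsto_pi_nhds.2 fun i => tendsto_restrictL_Iio (hp i) (x i)
    simpa [Function.comp_def] using
      ((PiTensorProduct.tprodL ℂ (E := fun i => Ell (p i))).cont.tendsto x).comp h
  | add v w hv hw =>
    simp only [map_add]
    exact hv.add hw

theorem eq_rect_Ici_add_sum (j : Fin N) (M : ℕ) (v : ⨂[ℂ] i, Ell (p i)) :
    v = rect p (Function.update (fun _ => Set.univ) j (Set.Ici M)) v
      + ∑ l ∈ Finset.range M, rect p (Function.update (fun _ => Set.univ) j {l}) v := by
  induction M with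
  | zero =>
    have : Function.update (fun _ : Fin N => (Set.univ : Set ℕ)) j (Set.Ici 0)
        = fun _ => Set.univ := by
      rw [Function.update_eq_self_iff]
      ext; simp
    rw [this, rect_univ]
    simp
  | succ M ih =>
    have hM : (Set.Ici M : Set ℕ) = Set.Ici (M + 1) ∪ {M} := by
      ext n
      simp only [Set.mem_Ici, Set.mem_union, Set.mem_singleton_iff]
      omega
    rw [hM, rect_update_union _ _ (by simp)] at ih
    rw [Finset.sum_range_succ]
    conv_lhs => rw [ih]
    abel

/-- Passing to the coordinates `≥ M` in every factor from `A` costs no more than the slices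
`n_j = l` with `j ∈ A` and `l < M`. -/
theorem norm_sub_rect_tail_le (A : Finset (Fin N)) (M : ℕ) (v : ⨂[ℂ] i, Ell (p i)) :
    ‖v - rect p (fun i => if i ∈ A then Set.Ici M else Set.univ) v‖
      ≤ ∑ j ∈ A, ∑ l ∈ Finset.range M,
          ‖rect p (Function.update (fun _ => Set.univ) j {l}) v‖ := by
  induction A using Finset.induction_on with
  | empty => simp [rect_univ]
  | insert j A hj ih =>
    set Q := rect p (fun i => if i ∈ A then Set.Ici M else Set.univ)
    set w := rect p (Function.update (fun _ => Set.univ) j (Set.Ici M)) v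
    have h1 : rect p (fun i => if i ∈ insert j A then Set.Ici M else Set.univ) v = Q w := by
      rw [rect_rect]
      congr 2
      funext i
      rcases eq_or_ne i j with rfl | hi
      · simp [hj]
      · simp [hi]
    have h2 : v - w = ∑ l ∈ Finset.range M,
        rect p (Function.update (fun _ => Set.univ) j {l}) v :=
      sub_eq_iff_eq_add'.2 (eq_rect_Ici_add_sum j M v)
    calc ‖v - rect p (fun i => if i ∈ insert j A then Set.Ici M else Set.univ) v‖
        = ‖Q (v - w) + (v - Q v)‖ := by rw [h1, map_sub]; congr 1; abel
      _ ≤ ‖v - w‖ + ‖v - Q v‖ :=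
        (norm_add_le _ _).trans (by gcongr; exact norm_rect_apply_le _ _)
      _ ≤ _ := by
        rw [Finset.sum_insert hj, h2]
        gcongr
        exact norm_sum_le _ _

end

/-! ### Hölder's inequality for several factors -/

theorem sum_prod_rpow_le {ι κ : Type*} (A : Finset ι) (T : Finset κ) {P : ι → ℝ}
    (hP : ∀ i ∈ A, 0 < P i) {r : ℝ} (hr : 0 < r) (hrP : r⁻¹ ≤ ∑ i ∈ A, (P i)⁻¹)
    {α : κ → ι → ℝ} (hα : ∀ k i, 0 ≤ α k i) {b : ι → ℝ} (hb : ∀ i, 0 ≤ b i)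
    (h : ∀ i ∈ A, ∑ k ∈ T, α k i ^ P i ≤ b i ^ P i) :
    ∑ k ∈ T, (∏ i ∈ A, α k i) ^ r ≤ (∏ i ∈ A, b i) ^ r := by
  have hle : ∀ i ∈ A, ∀ k ∈ T, α k i ≤ b i := fun i hi k hk => by
    have h1 := (Finset.single_le_sum (f := fun k => α k i ^ P i)
      (fun k _ => Real.rpow_nonneg (hα k i) _) hk).trans (h i hi)
    exact (Real.rpow_le_rpow_iff (hα k i) (hb i) (hP i hi)).1 h1
  by_cases h0 : ∃ i ∈ A, b i = 0
  · obtain ⟨i, hi, hbi⟩ := h0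
    refine le_trans (le_of_eq (Finset.sum_eq_zero fun k hk => ?_))
      (Real.rpow_nonneg (Finset.prod_nonneg fun i _ => hb i) _)
    rw [Finset.prod_eq_zero hi (le_antisymm (hbi ▸ hle i hi k hk) (hα k i)),
      Real.zero_rpow hr.ne']
  push Not at h0
  have hbpos : ∀ i ∈ A, 0 < b i := fun i hi => lt_of_le_of_ne (hb i) (h0 i hi).symm
  set Θ := ∑ i ∈ A, (P i)⁻¹
  have hΘ : 0 < Θ := (inv_pos.2 hr).trans_le hrP
  set γ : κ → ι → ℝ := fun k i => α k i / b i
  have hγ0 : ∀ k i, 0 ≤ γ k i := fun k i => div_nonneg (hα k i) (hb i)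
  have hγ1 : ∀ k ∈ T, ∀ i ∈ A, γ k i ≤ 1 := fun k hk i hi =>
    div_le_one_of_le₀ (hle i hi k hk) (hb i)
  have hγs : ∀ i ∈ A, ∑ k ∈ T, γ k i ^ P i ≤ 1 := fun i hi => by
    have : ∀ k, γ k i ^ P i = α k i ^ P i / b i ^ P i := fun k =>
      Real.div_rpow (hα k i) (hb i) _
    simp only [this]
    rw [← Finset.sum_div]
    exact div_le_one_of_le₀ (h i hi) (Real.rpow_nonneg (hb i) _)
  -- The weights `(P i)⁻¹ / Θ` sum to one, so the arithmetic-geometric mean inequality applies.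
  have hpt : ∀ k ∈ T, (∏ i ∈ A, γ k i) ^ r ≤ ∑ i ∈ A, (P i)⁻¹ / Θ * γ k i ^ P i := by
    intro k hk
    have hprod0 : 0 ≤ ∏ i ∈ A, γ k i := Finset.prod_nonneg fun i _ => hγ0 k i
    have hprod1 : ∏ i ∈ A, γ k i ≤ 1 :=
      Finset.prod_le_one (fun i _ => hγ0 k i) (hγ1 k hk)
    calc (∏ i ∈ A, γ k i) ^ r ≤ (∏ i ∈ A, γ k i) ^ Θ⁻¹ :=
          Real.rpow_le_rpow_of_exponent_ge' hprod0 hprod1 (inv_nonneg.2 hΘ.le)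
            (inv_le_of_inv_le₀ hr hrP)
      _ = ∏ i ∈ A, (γ k i ^ P i) ^ ((P i)⁻¹ / Θ) := by
          rw [← Real.finsetProd_rpow _ _ fun i _ => hγ0 k i]
          refine Finset.prod_congr rfl fun i hi => ?_
          rw [← Real.rpow_mul (hγ0 k i)]
          congr 1
          have := (hP i hi).ne'
          field_simp
      _ ≤ _ := by
          refine Real.geom_mean_le_arith_mean_weighted _ _ _
            (fun i hi => div_nonneg (inv_nonneg.2 (hP i hi).le) hΘ.le) ?_
            fun i _ => Real.rpow_nonneg (hγ0 k i) _
          rw [← Finset.sum_div]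
          exact div_self hΘ.ne'
  have hmain : ∑ k ∈ T, (∏ i ∈ A, γ k i) ^ r ≤ 1 := by
    refine (Finset.sum_le_sum hpt).trans ?_
    rw [Finset.sum_comm]
    calc ∑ i ∈ A, ∑ k ∈ T, (P i)⁻¹ / Θ * γ k i ^ P i ≤ ∑ i ∈ A, (P i)⁻¹ / Θ := by
          refine Finset.sum_le_sum fun i hi => ?_
          rw [← Finset.mul_sum]
          exact mul_le_of_le_one_right (div_nonneg (inv_nonneg.2 (hP i hi).le) hΘ.le) (hγs i hi)
      _ = 1 := by
          rw [← Finset.sum_div]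
          exact div_self hΘ.ne'
  have hfac : ∀ k, (∏ i ∈ A, α k i) ^ r = (∏ i ∈ A, b i) ^ r * (∏ i ∈ A, γ k i) ^ r := by
    intro k
    rw [← Real.mul_rpow (Finset.prod_nonneg fun i _ => hb i)
      (Finset.prod_nonneg fun i _ => hγ0 k i), ← Finset.prod_mul_distrib]
    congr 1
    exact Finset.prod_congr rfl fun i hi => (mul_div_cancel₀ _ (h0 i hi)).symm
  simp only [hfac]
  rw [← Finset.mul_sum]
  exact mul_le_of_le_one_right
    (Real.rpow_nonneg (Finset.prod_nonneg fun i _ => hb i) _) hmain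

/-! ### The lower estimate for diagonal blocks -/

section

variable {N : ℕ} {p : Fin N → ℝ≥0∞} [∀ i, Fact (1 ≤ p i)]

theorem opNorm_le_of_tprod {G : Type*} [SeminormedAddCommGroup G] [NormedSpace ℂ G]
    (L : (⨂[ℂ] i, Ell (p i)) →L[ℂ] G) {D : ℝ} (hD : 0 ≤ D)
    (h : ∀ x, ‖L (PiTensorProduct.tprod ℂ x)‖ ≤ D * ∏ i, ‖x i‖) : ‖L‖ ≤ D := by
  rw [← (PiTensorProduct.liftIsometry ℂ (fun i => Ell (p i)) G).symm.norm_map L]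
  refine ContinuousMultilinearMap.opNorm_le_bound hD fun x => ?_
  simpa using h x

/-- Rectangles with pairwise disjoint sides in the directions of `A` satisfy a lower
`r`-estimate as soon as `1 / r ≤ ∑ i ∈ A, 1 / p i`: the map `v ↦ (rect (S k) v)_k` into an
`ℓ_r`-sum is a contraction, since by Hölder's inequality it is one on elementary tensors. -/
theorem sum_norm_rect_rpow_le (hp : ∀ i, p i < ∞) (A : Finset (Fin N)) {r : ℝ} (hr : 1 ≤ r)
    (hrA : r⁻¹ ≤ ∑ i ∈ A, (p i).toReal⁻¹) (T : Finset ℕ) (S : ℕ → Fin N → Set ℕ)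
    (hS : ∀ i ∈ A, (T : Set ℕ).PairwiseDisjoint fun k => S k i) (v : ⨂[ℂ] i, Ell (p i)) :
    ∑ k ∈ T, ‖rect p (S k) v‖ ^ r ≤ ‖v‖ ^ r := by
  have hr0 : 0 < r := zero_lt_one.trans_le hr
  have : Fact (1 ≤ ENNReal.ofReal r) := ⟨by simpa using ENNReal.ofReal_le_ofReal hr⟩
  have htr : (ENNReal.ofReal r).toReal = r := ENNReal.toReal_ofReal hr0.le
  let L : (⨂[ℂ] i, Ell (p i)) →L[ℂ]
      PiLp (ENNReal.ofReal r) (fun _ : T => ⨂[ℂ] i, Ell (p i)) :=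
    (PiLp.continuousLinearEquiv (ENNReal.ofReal r) ℂ
        (fun _ : T => ⨂[ℂ] i, Ell (p i))).symm.toContinuousLinearMap ∘L
      ContinuousLinearMap.pi fun k : T => rect p (S k)
  have hLv : ∀ v, ‖L v‖ ^ r = ∑ k ∈ T, ‖rect p (S k) v‖ ^ r := by
    intro v
    rw [PiLp.norm_eq_sum (by rw [htr]; exact hr0), htr, ← Real.rpow_mul (by positivity),
      one_div_mul_cancel hr0.ne', Real.rpow_one]
    exact Finset.sum_coe_sort T fun k => ‖rect p (S k) v‖ ^ r
  have hL : ‖L‖ ≤ 1 := by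
    refine opNorm_le_of_tprod L zero_le_one fun x => ?_
    rw [one_mul, ← Real.rpow_le_rpow_iff (norm_nonneg _) (by positivity) hr0, hLv]
    have hb : 0 ≤ ∏ i ∈ Aᶜ, ‖x i‖ := by positivity
    calc ∑ k ∈ T, ‖rect p (S k) (PiTensorProduct.tprod ℂ x)‖ ^ r
        ≤ ∑ k ∈ T, ((∏ i ∈ A, ‖restrictL (p i) (S k i) (x i)‖) * ∏ i ∈ Aᶜ, ‖x i‖) ^ r := by
          refine Finset.sum_le_sum fun k _ => Real.rpow_le_rpow (norm_nonneg _) ?_ hr0.le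
          rw [rect_tprod]
          refine (PiTensorProduct.projectiveSeminorm_tprod_le _).trans ?_
          rw [← Finset.prod_mul_prod_compl A]
          gcongr with i hi
          exact norm_restrictL_apply_le _ _
      _ = (∑ k ∈ T, (∏ i ∈ A, ‖restrictL (p i) (S k i) (x i)‖) ^ r)
            * (∏ i ∈ Aᶜ, ‖x i‖) ^ r := by
          rw [Finset.sum_mul]
          exact Finset.sum_congr rfl fun k _ => Real.mul_rpow (by positivity) hb
      _ ≤ (∏ i ∈ A, ‖x i‖) ^ r * (∏ i ∈ Aᶜ, ‖x i‖) ^ r := by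
          gcongr
          exact sum_prod_rpow_le A T (P := fun i => (p i).toReal)
            (α := fun k i => ‖restrictL (p i) (S k i) (x i)‖) (b := fun i => ‖x i‖)
            (fun i _ => toReal_pos _ (hp i)) hr0 hrA
            (fun _ _ => norm_nonneg _) (fun _ => norm_nonneg _)
            fun i hi => sum_norm_restrictL_rpow_le (hp i) T (fun k => S k i) (hS i hi) (x i)
      _ = (∏ i, ‖x i‖) ^ r := by
          rw [← Real.mul_rpow (by positivity) hb, Finset.prod_mul_prod_compl]
  rw [← hLv]
  refine Real.rpow_le_rpow (norm_nonneg _) ?_ hr0.le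
  simpa using L.le_of_opNorm_le hL v

/-! ### The upper estimate for diagonal blocks -/

/-- Averaging over the `n`-th roots of unity, `n = #A`, decouples two tensors that differ only
in the factors from `A`. -/
theorem sum_multilinear_add_root_smul {ι : Type*} [DecidableEq ι] {E : ι → Type*} {G : Type*}
    [∀ i, AddCommGroup (E i)] [∀ i, Module ℂ (E i)] [AddCommGroup G] [Module ℂ G]
    (f : MultilinearMap ℂ E G) {A : Finset ι} (hA : A.Nonempty) {a b : ∀ i, E i}
    (hab : ∀ i ∉ A, b i = a i) {ζ : ℂ} (hζ : IsPrimitiveRoot ζ A.card) :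
    ∑ j ∈ Finset.range A.card, f (A.piecewise (fun i => a i + ζ ^ j • b i) a)
      = (A.card : ℂ) • (f a + f b) := by
  have hexp : ∀ j, f (A.piecewise (fun i => a i + ζ ^ j • b i) a)
      = ∑ s ∈ A.powerset, ((ζ ^ s.card) ^ j) • f (s.piecewise b a) := by
    intro j
    have h1 : (fun i => a i + ζ ^ j • b i) = (fun i => ζ ^ j • b i) + a := by
      funext i
      exact add_comm _ _
    rw [h1, f.map_piecewise_add]
    refine Finset.sum_congr rfl fun s _ => ?_
    have h2 := f.map_piecewise_smul (fun _ => ζ ^ j) (s.piecewise b a) s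
    have h3 : s.piecewise (fun i => ζ ^ j • s.piecewise b a i) (s.piecewise b a)
        = s.piecewise (fun i => ζ ^ j • b i) a := by
      funext i
      by_cases hi : i ∈ s <;> simp [hi]
    rw [h3, Finset.prod_const] at h2
    rw [h2, ← pow_mul, ← pow_mul, mul_comm]
  have hb : A.piecewise b a = b := by
    funext i
    by_cases hi : i ∈ A
    · simp [hi]
    · simp [hi, hab i hi]
  simp only [hexp]
  rw [Finset.sum_comm]
  simp only [← Finset.sum_smul]
  rw [Finset.sum_eq_add (∅ : Finset ι) A hA.ne_empty.symm]
  · simp [hb, hζ.pow_eq_one]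
  · intro s hs hs'
    have hsA := Finset.mem_powerset.1 hs
    have hne : ζ ^ s.card ≠ 1 := hζ.pow_ne_one_of_pos_of_lt
      (Finset.card_pos.2 (Finset.nonempty_of_ne_empty hs'.1)).ne'
      (Finset.card_lt_card (lt_of_le_of_ne hsA hs'.2))
    have hg := geom_sum_eq hne A.card
    rw [← pow_mul, mul_comm, pow_mul, hζ.pow_eq_one, one_pow, sub_self, zero_div] at hg
    rw [hg, zero_smul]
  · simp
  · simp

/-- Adding the tensors `u k` one at a time: by the averaging identity, `⊗ x + ⊗ (u k)` is a mean of
tensors `⊗ (x + ζ • u k)`, and the disjointness of supports controls the norms of their factors.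
The factors outside `A` are common to all tensors. -/
theorem norm_tprod_add_sum_tprod_le (hp : ∀ i, p i < ∞) {A : Finset (Fin N)} (hA : A.Nonempty)
    (T : Finset ℕ) (u : ℕ → ∀ i, Ell (p i)) (x : ∀ i, Ell (p i))
    (hxu : ∀ i ∈ A, ∀ k ∈ T, ∀ n, x i n = 0 ∨ u k i n = 0)
    (huu : ∀ i ∈ A, ∀ k ∈ T, ∀ l ∈ T, k ≠ l → ∀ n, u k i n = 0 ∨ u l i n = 0)
    (hoff : ∀ i ∉ A, ∀ k ∈ T, u k i = x i) :
    ‖PiTensorProduct.tprod ℂ x + ∑ k ∈ T, PiTensorProduct.tprod ℂ (u k)‖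
      ≤ (∏ i ∈ A, (‖x i‖ ^ (p i).toReal + ∑ k ∈ T, ‖u k i‖ ^ (p i).toReal) ^ (p i).toReal⁻¹)
        * ∏ i ∈ Aᶜ, ‖x i‖ := by
  induction T using Finset.induction_on generalizing x with
  | empty =>
    simp only [Finset.sum_empty, add_zero]
    refine (PiTensorProduct.projectiveSeminorm_tprod_le x).trans (le_of_eq ?_)
    rw [← Finset.prod_mul_prod_compl A]
    congr 1
    exact Finset.prod_congr rfl fun i _ =>
      (Real.rpow_rpow_inv (norm_nonneg _) (toReal_pos _ (hp i)).ne').symm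
  | insert k T hk ih =>
    set n := A.card
    have hn : n ≠ 0 := (Finset.card_pos.2 hA).ne'
    set ζ : ℂ := Complex.exp (2 * Real.pi * Complex.I / n)
    have hζ : IsPrimitiveRoot ζ n := Complex.isPrimitiveRoot_exp n hn
    have hζ1 : ‖ζ‖ = 1 := hζ.norm'_eq_one hn
    set R := ∑ k ∈ T, PiTensorProduct.tprod ℂ (u k)
    set y : ℕ → ∀ i, Ell (p i) := fun j => A.piecewise (fun i => x i + ζ ^ j • u k i) x
    have hid : (n : ℂ) • (PiTensorProduct.tprod ℂ x + (PiTensorProduct.tprod ℂ (u k) + R))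
        = ∑ j ∈ Finset.range n, (PiTensorProduct.tprod ℂ (y j) + R) := by
      rw [Finset.sum_add_distrib, sum_multilinear_add_root_smul _ hA
        (fun i hi => hoff i hi k (by simp)) hζ, ← add_assoc, smul_add (n : ℂ) (_ + _) R]
      simp [Nat.cast_smul_eq_nsmul, n]
    have hy : ∀ j, ‖PiTensorProduct.tprod ℂ (y j) + R‖
        ≤ (∏ i ∈ A, (‖x i‖ ^ (p i).toReal + ∑ k ∈ insert k T, ‖u k i‖ ^ (p i).toReal)
            ^ (p i).toReal⁻¹) * ∏ i ∈ Aᶜ, ‖x i‖ := by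
      intro j
      refine (ih (y j) ?_ ?_ ?_).trans (le_of_eq ?_)
      · intro i hi l hl m
        have hkl : k ≠ l := fun h => hk (h ▸ hl)
        rcases hxu i hi l (by simp [hl]) m with h | h
        · rcases huu i hi k (by simp) l (by simp [hl]) hkl m with h' | h'
          · left
            have h1 : y j i = x i + ζ ^ j • u k i := by simp [y, hi]
            rw [h1, lp.coeFn_add]
            change x i m + ζ ^ j * u k i m = 0
            rw [h, h', mul_zero, add_zero]
          · exact Or.inr h'
        · exact Or.inr h
      · exact fun i hi l hl l' hl' => huu i hi l (by simp [hl]) l' (by simp [hl'])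
      · intro i hi l hl
        simp [y, hi, hoff i hi l (by simp [hl])]
      · congr 1
        · refine Finset.prod_congr rfl fun i hi => ?_
          have h1 : y j i = x i + ζ ^ j • u k i := by simp [y, hi]
          rw [h1, norm_add_rpow (hp i), norm_smul, norm_pow, hζ1, one_pow, one_mul,
            Finset.sum_insert hk, add_assoc]
          intro m
          rcases hxu i hi k (by simp) m with h | h
          · exact Or.inl h
          · right; simp [h]
        · refine Finset.prod_congr rfl fun i hi => ?_
          simp [y, Finset.mem_compl.1 hi]
    rw [Finset.sum_insert hk]
    have hn' : (0 : ℝ) < n := by positivity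
    refine le_of_mul_le_mul_left ?_ hn'
    calc (n : ℝ) * ‖PiTensorProduct.tprod ℂ x + (PiTensorProduct.tprod ℂ (u k) + R)‖
        = ‖(n : ℂ) • (PiTensorProduct.tprod ℂ x + (PiTensorProduct.tprod ℂ (u k) + R))‖ := by
          rw [norm_smul]; simp
      _ ≤ ∑ j ∈ Finset.range n, ‖PiTensorProduct.tprod ℂ (y j) + R‖ := by
          rw [hid]; exact norm_sum_le _ _
      _ ≤ _ := (Finset.sum_le_sum fun j _ => hy j).trans (by simp)

end

section

variable {N : ℕ} {p : Fin N → ℝ≥0∞} [∀ i, Fact (1 ≤ p i)]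

theorem norm_sum_tprod_le (hp : ∀ i, p i < ∞) {A : Finset (Fin N)} (hA : A.Nonempty)
    (T : Finset ℕ) (u : ℕ → ∀ i, Ell (p i)) (v : ∀ i, Ell (p i))
    (huu : ∀ i ∈ A, ∀ k ∈ T, ∀ l ∈ T, k ≠ l → ∀ n, u k i n = 0 ∨ u l i n = 0)
    (hoff : ∀ i ∉ A, ∀ k ∈ T, u k i = v i) :
    ‖∑ k ∈ T, PiTensorProduct.tprod ℂ (u k)‖
      ≤ (∏ i ∈ A, (∑ k ∈ T, ‖u k i‖ ^ (p i).toReal) ^ (p i).toReal⁻¹) * ∏ i ∈ Aᶜ, ‖v i‖ := by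
  obtain ⟨i₀, hi₀⟩ := hA
  have h := norm_tprod_add_sum_tprod_le hp ⟨i₀, hi₀⟩ T u (A.piecewise 0 v)
    (fun i hi k _ n => Or.inl (by simp [hi])) huu (fun i hi k hk => by simp [hi, hoff i hi k hk])
  rw [(PiTensorProduct.tprod ℂ).map_coord_zero i₀ (by simp [hi₀]), zero_add] at h
  refine h.trans (le_of_eq ?_)
  congr 1
  · refine Finset.prod_congr rfl fun i hi => ?_
    simp [hi, Real.zero_rpow (toReal_pos _ (hp i)).ne']
  · refine Finset.prod_congr rfl fun i hi => ?_
    simp [Finset.mem_compl.1 hi]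

/-- The upper `r`-estimate for elementary tensors with disjointly supported factors in the
directions of `A`. If `1 / r = ∑ i ∈ A, 1 / p i`, the norm of each tensor is first distributed
over its factors in the proportions for which Hölder's inequality is an equality. -/
theorem norm_sum_tprod_le_rpow (hp : ∀ i, p i < ∞) {A : Finset (Fin N)} (hA : A.Nonempty)
    {r : ℝ} (hr : 1 ≤ r) (hrA : r = 1 ∨ r⁻¹ = ∑ i ∈ A, (p i).toReal⁻¹)
    (T : Finset ℕ) (u : ℕ → ∀ i, Ell (p i)) (v : ∀ i, Ell (p i))
    (huu : ∀ i ∈ A, ∀ k ∈ T, ∀ l ∈ T, k ≠ l → ∀ n, u k i n = 0 ∨ u l i n = 0)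
    (hoff : ∀ i ∉ A, ∀ k ∈ T, u k i = v i) :
    ‖∑ k ∈ T, PiTensorProduct.tprod ℂ (u k)‖
      ≤ (∑ k ∈ T, (∏ i ∈ A, ‖u k i‖) ^ r) ^ r⁻¹ * ∏ i ∈ Aᶜ, ‖v i‖ := by
  have hr0 : 0 < r := zero_lt_one.trans_le hr
  rcases hrA with rfl | hrA
  · simp only [Real.rpow_one, inv_one]
    rw [Finset.sum_mul]
    refine (norm_sum_le _ _).trans (Finset.sum_le_sum fun k hk => ?_)
    refine (PiTensorProduct.projectiveSeminorm_tprod_le _).trans (le_of_eq ?_)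
    rw [← Finset.prod_mul_prod_compl A]
    congr 1
    exact Finset.prod_congr rfl fun i hi => by rw [hoff i (Finset.mem_compl.1 hi) k hk]
  set τ : ℕ → ℝ := fun k => ∏ i ∈ A, ‖u k i‖
  have hτ0 : ∀ k, 0 ≤ τ k := fun k => Finset.prod_nonneg fun _ _ => norm_nonneg _
  set T' := T.filter fun k => τ k ≠ 0
  have hu0 : ∀ k ∈ T', ∀ i ∈ A, ‖u k i‖ ≠ 0 := fun k hk i hi =>
    Finset.prod_ne_zero_iff.1 (Finset.mem_filter.1 hk).2 i hi
  have hτpos : ∀ k ∈ T', 0 < τ k := fun k hk =>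
    lt_of_le_of_ne (hτ0 k) (Finset.mem_filter.1 hk).2.symm
  set d : ℕ → Fin N → ℝ := fun k i => if i ∈ A then τ k ^ (r / (p i).toReal) / ‖u k i‖ else 1
  set u' : ℕ → ∀ i, Ell (p i) := fun k i => (d k i : ℂ) • u k i
  have hd : ∀ k ∈ T', ∏ i, d k i = 1 := by
    intro k hk
    have h1 : ∏ i, d k i = ∏ i ∈ A, τ k ^ (r / (p i).toReal) / ‖u k i‖ := by
      rw [← Finset.prod_subset A.subset_univ (fun i _ hi => by simp [d, hi])]
      exact Finset.prod_congr rfl fun i hi => by simp [d, hi]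
    rw [h1, Finset.prod_div_distrib, ← Real.rpow_sum_of_pos (hτpos k hk)]
    have h2 : ∑ i ∈ A, r / (p i).toReal = 1 := by
      simp only [div_eq_mul_inv]
      rw [← Finset.mul_sum, ← hrA, mul_inv_cancel₀ hr0.ne']
    rw [h2, Real.rpow_one]
    exact div_self (hτpos k hk).ne'
  have htp : ∀ k ∈ T', PiTensorProduct.tprod ℂ (u' k) = PiTensorProduct.tprod ℂ (u k) := by
    intro k hk
    rw [show PiTensorProduct.tprod ℂ (u' k) = (∏ i, (d k i : ℂ)) • PiTensorProduct.tprod ℂ (u k)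
      from (PiTensorProduct.tprod ℂ).map_smul_univ (fun i => (d k i : ℂ)) (u k),
      ← Complex.ofReal_prod, hd k hk]
    simp
  have hsum : ∑ k ∈ T, PiTensorProduct.tprod ℂ (u k) = ∑ k ∈ T', PiTensorProduct.tprod ℂ (u' k) := by
    rw [Finset.sum_congr rfl htp, Finset.sum_filter_of_ne]
    intro k _ hne h0
    obtain ⟨i, hi, hi0⟩ := Finset.prod_eq_zero_iff.1 h0
    exact hne ((PiTensorProduct.tprod ℂ).map_coord_zero i (norm_eq_zero.1 hi0))
  have hnorm : ∀ k ∈ T', ∀ i ∈ A, ‖u' k i‖ ^ (p i).toReal = τ k ^ r := by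
    intro k hk i hi
    have hpos := Real.rpow_nonneg (hτ0 k) (r / (p i).toReal)
    have h1 : ‖u' k i‖ = τ k ^ (r / (p i).toReal) := by
      simp only [u', d, if_pos hi, norm_smul, Complex.norm_real, Real.norm_eq_abs]
      rw [abs_of_nonneg (div_nonneg hpos (norm_nonneg _)), div_mul_cancel₀ _ (hu0 k hk i hi)]
    rw [h1, ← Real.rpow_mul (hτ0 k), div_mul_cancel₀ _ (toReal_pos _ (hp i)).ne']
  have h_sum_nonneg : 0 ≤ ∑ k ∈ T', τ k ^ r := Finset.sum_nonneg fun k _ => Real.rpow_nonneg (hτ0 k) _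
  rw [hsum]
  refine (norm_sum_tprod_le hp hA T' u' v ?_ ?_).trans ?_
  · intro i hi k hk l hl hkl n
    refine (huu i hi k (Finset.mem_filter.1 hk).1 l (Finset.mem_filter.1 hl).1 hkl n).imp ?_ ?_
    · intro h
      change (d k i : ℂ) * u k i n = 0
      rw [h, mul_zero]
    · intro h
      change (d l i : ℂ) * u l i n = 0
      rw [h, mul_zero]
  · intro i hi k hk
    have h1 : d k i = 1 := if_neg hi
    change (d k i : ℂ) • u k i = v i
    rw [h1, Complex.ofReal_one, one_smul, hoff i hi k (Finset.mem_filter.1 hk).1]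
  · gcongr
    calc ∏ i ∈ A, (∑ k ∈ T', ‖u' k i‖ ^ (p i).toReal) ^ (p i).toReal⁻¹
        = ∏ i ∈ A, (∑ k ∈ T', τ k ^ r) ^ (p i).toReal⁻¹ :=
          Finset.prod_congr rfl fun i hi => by
            rw [Finset.sum_congr rfl fun k hk => hnorm k hk i hi]
      _ = (∑ k ∈ T', τ k ^ r) ^ r⁻¹ := by
          rw [hrA, Real.rpow_sum_of_nonneg h_sum_nonneg fun i _ => inv_nonneg.2 (toReal_pos _ (hp i)).le]
      _ ≤ (∑ k ∈ T, τ k ^ r) ^ r⁻¹ :=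
          Real.rpow_le_rpow h_sum_nonneg
            (Finset.sum_le_sum_of_subset_of_nonneg (Finset.filter_subset _ T)
              fun k _ _ => Real.rpow_nonneg (hτ0 k) _) (inv_nonneg.2 hr0.le)

/-- The rectangle with side `J` in the directions of `A` and side `{f i}` in the other
directions. -/
def slab (A : Finset (Fin N)) (f : Fin N → ℕ) (J : Set ℕ) : Fin N → Set ℕ :=
  fun i => if i ∈ A then J else {f i}

theorem rect_slab_tprod (A : Finset (Fin N)) (f : Fin N → ℕ) (J : Set ℕ)
    (x : ∀ i, Ell (p i)) :
    rect p (slab A f J) (PiTensorProduct.tprod ℂ x)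
      = (∏ i ∈ Aᶜ, x i (f i)) • PiTensorProduct.tprod ℂ
          (A.piecewise (fun i => restrictL (p i) J (x i)) fun i => lp.single (p i) (f i) (1 : ℂ)) := by
  set y : ∀ i, Ell (p i) :=
    A.piecewise (fun i => restrictL (p i) J (x i)) fun i => lp.single (p i) (f i) (1 : ℂ)
  set c : Fin N → ℂ := fun i => if i ∈ A then 1 else x i (f i)
  have hc : ∏ i, c i = ∏ i ∈ Aᶜ, x i (f i) := by
    rw [← Finset.prod_subset (Aᶜ).subset_univ (fun i _ hi => by
      simp [c, Finset.notMem_compl.1 hi])]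
    exact Finset.prod_congr rfl fun i hi => by simp [c, Finset.mem_compl.1 hi]
  rw [rect_tprod, ← hc, ← MultilinearMap.map_smul_univ]
  congr 1
  funext i
  by_cases hi : i ∈ A
  · simp [slab, c, y, hi]
  · simp only [slab, c, y, hi, if_false, Finset.piecewise_eq_of_notMem, not_false_eq_true]
    exact restrictL_singleton (f i) (x i)

theorem norm_sum_smul_rect_slab_tprod_le (hp : ∀ i, p i < ∞) {A : Finset (Fin N)}
    (hA : A.Nonempty) {r : ℝ} (hr : 1 ≤ r) (hrA : r = 1 ∨ r⁻¹ = ∑ i ∈ A, (p i).toReal⁻¹)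
    (f : Fin N → ℕ) (T : Finset ℕ) (I : ℕ → Set ℕ) (hI : (T : Set ℕ).PairwiseDisjoint I)
    (c : ℕ → ℂ) (x : ℕ → ∀ i, Ell (p i)) :
    ‖∑ k ∈ T, c k • rect p (slab A f (I k)) (PiTensorProduct.tprod ℂ (x k))‖
      ≤ (∑ k ∈ T, (‖c k‖ * ∏ i, ‖x k i‖) ^ r) ^ r⁻¹ := by
  have hr0 : 0 < r := zero_lt_one.trans_le hr
  obtain ⟨i₀, hi₀⟩ := id hA
  set e : ∀ i, Ell (p i) := fun i => lp.single (p i) (f i) (1 : ℂ)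
  set y : ℕ → ∀ i, Ell (p i) := fun k => A.piecewise (fun i => restrictL (p i) (I k) (x k i)) e
  set g : ℕ → ℂ := fun k => c k * ∏ i ∈ Aᶜ, x k i (f i)
  -- All scalars are absorbed into the factor with index `i₀`.
  set u : ℕ → ∀ i, Ell (p i) := fun k => Function.update (y k) i₀ (g k • y k i₀)
  have hu : ∀ k, c k • rect p (slab A f (I k)) (PiTensorProduct.tprod ℂ (x k))
      = PiTensorProduct.tprod ℂ (u k) := by
    intro k
    rw [rect_slab_tprod, smul_smul, MultilinearMap.map_update_smul, Function.update_eq_self]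
  have hsupp : ∀ k, ∀ i ∈ A, ∀ n, n ∉ I k → u k i n = 0 := by
    intro k i hi n hn
    have h1 : y k i n = 0 := by simp [y, hi, restrictL_apply, hn]
    rcases eq_or_ne i i₀ with rfl | hne
    · simp [u, h1]
    · simp [u, hne, h1]
  have hoff : ∀ i ∉ A, ∀ k, u k i = e i := by
    intro i hi k
    have hne : i ≠ i₀ := fun h => hi (h ▸ hi₀)
    simp [u, hne, y, hi]
  have hprod : ∀ k, ∏ i ∈ A, ‖u k i‖ ≤ ‖c k‖ * ∏ i, ‖x k i‖ := by
    intro k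
    have h1 : ∏ i ∈ A, ‖u k i‖ = ‖g k‖ * ∏ i ∈ A, ‖y k i‖ := by
      rw [← Finset.mul_prod_erase A _ hi₀, ← Finset.mul_prod_erase A (fun i => ‖y k i‖) hi₀,
        ← mul_assoc]
      congr 1
      · simp [u, norm_smul]
      · exact Finset.prod_congr rfl fun i hi => by simp [u, Finset.ne_of_mem_erase hi]
    rw [h1, norm_mul, norm_prod, ← Finset.prod_mul_prod_compl A, mul_assoc,
      mul_comm (∏ i ∈ Aᶜ, ‖x k i (f i)‖)]
    gcongr with i hi i hi
    · simp only [y, hi, Finset.piecewise_eq_of_mem]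
      exact norm_restrictL_apply_le _ _
    · exact lp.norm_apply_le_norm (zero_lt_one.trans_le Fact.out).ne' _ _
  simp only [hu]
  refine (norm_sum_tprod_le_rpow hp hA hr hrA T u e ?_ fun i hi k _ => hoff i hi k).trans ?_
  · intro i hi k hk l hl hkl n
    by_cases hn : n ∈ I k
    · exact Or.inr (hsupp l i hi n (Set.disjoint_left.1 (hI hk hl hkl) hn))
    · exact Or.inl (hsupp k i hi n hn)
  · have he : ∏ i ∈ Aᶜ, ‖e i‖ = 1 := Finset.prod_eq_one fun i _ => by
      simp [e, lp.norm_single (zero_lt_one.trans_le (Fact.out : 1 ≤ p i))]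
    rw [he, mul_one]
    exact Real.rpow_le_rpow
      (Finset.sum_nonneg fun k _ => Real.rpow_nonneg (Finset.prod_nonneg fun i _ => norm_nonneg _) _)
      (Finset.sum_le_sum fun k _ => Real.rpow_le_rpow
        (Finset.prod_nonneg fun i _ => norm_nonneg _) (hprod k) hr0.le) (inv_nonneg.2 hr0.le)

/-- Diagonal blocks satisfy an upper `r`-estimate. By the Hahn-Banach theorem the blocks may be
replaced with elementary tensors that almost norm the restriction of a functional to the
corresponding slab. -/
theorem norm_sum_le_of_slab (hp : ∀ i, p i < ∞) {A : Finset (Fin N)}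
    (hA : A.Nonempty) {r : ℝ} (hr : 1 ≤ r) (hrA : r = 1 ∨ r⁻¹ = ∑ i ∈ A, (p i).toReal⁻¹)
    (f : Fin N → ℕ) (T : Finset ℕ) (I : ℕ → Set ℕ) (hI : (T : Set ℕ).PairwiseDisjoint I)
    (w : ℕ → ⨂[ℂ] i, Ell (p i)) (hw : ∀ k ∈ T, rect p (slab A f (I k)) (w k) = w k) :
    ‖∑ k ∈ T, w k‖ ≤ 2 * (∑ k ∈ T, ‖w k‖ ^ r) ^ r⁻¹ := by
  have hr0 : 0 < r := zero_lt_one.trans_le hr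
  obtain ⟨φ, hφ, hφw⟩ := exists_dual_vector'' ℂ (∑ k ∈ T, w k)
  set ψ : ℕ → (⨂[ℂ] i, Ell (p i)) →L[ℂ] ℂ := fun k => φ ∘L rect p (slab A f (I k))
  have hex : ∀ k, ∃ (c : ℂ) (x : ∀ i, Ell (p i)), ‖c‖ * ∏ i, ‖x i‖ ≤ ‖w k‖ ∧
      c * ψ k (PiTensorProduct.tprod ℂ x) = ((‖ψ k‖ * ‖w k‖ / 2 : ℝ) : ℂ) := by
    intro k
    rcases (norm_nonneg (ψ k)).eq_or_lt with h0 | h0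
    · exact ⟨0, 0, by simp, by simp [← h0]⟩
    obtain ⟨x, hx⟩ : ∃ x, ‖ψ k‖ / 2 * ∏ i, ‖x i‖ < ‖ψ k (PiTensorProduct.tprod ℂ x)‖ := by
      by_contra! h
      have := opNorm_le_of_tprod (ψ k) (by positivity) h
      linarith
    set g := ψ k (PiTensorProduct.tprod ℂ x)
    have hg : 0 < ‖g‖ := lt_of_le_of_lt (by positivity) hx
    refine ⟨((‖ψ k‖ * ‖w k‖ / 2 : ℝ) : ℂ) / g, x, ?_, div_mul_cancel₀ _ (norm_pos_iff.1 hg)⟩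
    rw [norm_div, Complex.norm_real, Real.norm_eq_abs, abs_of_nonneg (by positivity),
      div_mul_eq_mul_div, div_le_iff₀ hg]
    calc ‖ψ k‖ * ‖w k‖ / 2 * ∏ i, ‖x i‖ = ‖w k‖ * (‖ψ k‖ / 2 * ∏ i, ‖x i‖) := by ring
      _ ≤ ‖w k‖ * ‖g‖ := by gcongr
  choose c x hcx hψ using hex
  set z := ∑ k ∈ T, c k • rect p (slab A f (I k)) (PiTensorProduct.tprod ℂ (x k))
  have hz : φ z = ((∑ k ∈ T, ‖ψ k‖ * ‖w k‖ / 2 : ℝ) : ℂ) := by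
    rw [map_sum, Complex.ofReal_sum]
    refine Finset.sum_congr rfl fun k _ => ?_
    rw [map_smul, smul_eq_mul, ← hψ k]
    rfl
  have hW : ‖∑ k ∈ T, w k‖ ≤ ∑ k ∈ T, ‖ψ k‖ * ‖w k‖ := by
    have h1 : ‖φ (∑ k ∈ T, w k)‖ = ‖∑ k ∈ T, w k‖ := by rw [hφw]; simp
    rw [← h1, map_sum]
    refine (norm_sum_le _ _).trans (Finset.sum_le_sum fun k hk => ?_)
    have h2 : φ (w k) = ψ k (w k) := by
      change φ (w k) = φ (rect p (slab A f (I k)) (w k))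
      rw [hw k hk]
    rw [h2]
    exact (ψ k).le_opNorm _
  have hnn : 0 ≤ ∑ k ∈ T, ‖ψ k‖ * ‖w k‖ / 2 := Finset.sum_nonneg fun k _ => by positivity
  have hzle : ∑ k ∈ T, ‖ψ k‖ * ‖w k‖ / 2 ≤ ‖z‖ := by
    have h1 := φ.le_of_opNorm_le hφ z
    rwa [hz, Complex.norm_real, Real.norm_eq_abs, abs_of_nonneg hnn, one_mul] at h1
  have hzu : ‖z‖ ≤ (∑ k ∈ T, ‖w k‖ ^ r) ^ r⁻¹ := by
    refine (norm_sum_smul_rect_slab_tprod_le hp hA hr hrA f T I hI c x).trans ?_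
    gcongr with k hk
    exact hcx k
  rw [← Finset.sum_div] at hzle
  linarith

theorem rect_eq_zero {S : Fin N → Set ℕ} {i : Fin N} (hi : S i = ∅) (v : ⨂[ℂ] i, Ell (p i)) :
    rect p S v = 0 := by
  have h := rect_update_union S i (Set.disjoint_empty (∅ : Set ℕ)) v
  rw [Set.union_empty, ← hi, Function.update_eq_self] at h
  exact left_eq_add.1 h

theorem sum_norm_rpow_le_of_slab (hp : ∀ i, p i < ∞) {A : Finset (Fin N)}
    (hA : A.Nonempty) {r : ℝ} (hr : 1 ≤ r) (hrA : r⁻¹ ≤ ∑ i ∈ A, (p i).toReal⁻¹)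
    (f : Fin N → ℕ) (T : Finset ℕ) (I : ℕ → Set ℕ) (hI : (T : Set ℕ).PairwiseDisjoint I)
    (w : ℕ → ⨂[ℂ] i, Ell (p i)) (hw : ∀ k ∈ T, rect p (slab A f (I k)) (w k) = w k) :
    ∑ k ∈ T, ‖w k‖ ^ r ≤ ‖∑ k ∈ T, w k‖ ^ r := by
  obtain ⟨i₀, hi₀⟩ := id hA
  refine le_trans (le_of_eq (Finset.sum_congr rfl fun k hk => ?_))
    (sum_norm_rect_rpow_le hp A hr hrA T (fun k => slab A f (I k)) ?_ _)
  · rw [map_sum, Finset.sum_eq_single k, hw k hk]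
    · intro l hl hlk
      rw [← hw l hl, rect_rect]
      refine rect_eq_zero (i := i₀) ?_ _
      simpa [slab, hi₀] using (hI hk hl hlk.symm).inter_eq
    · exact fun h => absurd hk h
  · intro i hi
    simpa [slab, hi] using hI

end

/-! ### Block maps on the finitely supported sequences -/

theorem exists_seq_of_step {α : Type*} {R : ℕ → ℕ → α → ℕ → Prop}
    (h : ∀ k m, ∃ a m', R k m a m') :
    ∃ (a : ℕ → α) (m : ℕ → ℕ), ∀ k, R k (m k) (a k) (m (k + 1)) := by
  choose a m' hR using h
  let m : ℕ → ℕ := fun k => Nat.rec 0 (fun k m => m' k m) k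
  exact ⟨fun k => a k (m k), m, fun k => hR k (m k)⟩

/-- A linear map of the finitely supported sequences that is isometric for the `ℓ_s`-norm and
sends sequences supported in `[m, ∞)` to such sequences, for all `m`; for instance, the map
sending the unit vectors to successive normalized blocks. -/
structure IsBlockMap (s : ℝ≥0∞) (β : (ℕ →₀ ℂ) →ₗ[ℂ] (ℕ →₀ ℂ)) : Prop where
  norm_map : ∀ a, ‖ofFinsupp s (β a)‖ = ‖ofFinsupp s a‖
  tail_map : ∀ (m : ℕ) (a : ℕ →₀ ℂ), (∀ n < m, a n = 0) → ∀ n < m, β a n = 0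

theorem IsBlockMap.id {s : ℝ≥0∞} : IsBlockMap s LinearMap.id := ⟨fun _ => rfl, fun _ _ h => h⟩

theorem IsBlockMap.comp {s : ℝ≥0∞} {β γ : (ℕ →₀ ℂ) →ₗ[ℂ] (ℕ →₀ ℂ)} (hβ : IsBlockMap s β)
    (hγ : IsBlockMap s γ) : IsBlockMap s (β ∘ₗ γ) :=
  ⟨fun a => (hβ.norm_map _).trans (hγ.norm_map a),
    fun m a h => hβ.tail_map m _ (hγ.tail_map m a h)⟩

section

variable {s : ℝ≥0∞} [Fact (1 ≤ s)]

theorem isBlockMap_linearCombination (hs : s < ∞) {a : ℕ → ℕ →₀ ℂ} {m : ℕ → ℕ}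
    (hm : ∀ k, m k < m (k + 1)) (hlow : ∀ k, ∀ n < m k, a k n = 0)
    (hup : ∀ k n, m (k + 1) ≤ n → a k n = 0) (hnorm : ∀ k, ‖ofFinsupp s (a k)‖ = 1) :
    IsBlockMap s (Finsupp.linearCombination ℂ a) := by
  have hs0 := toReal_pos s hs
  have hmono : StrictMono m := strictMono_nat_of_lt_succ hm
  have hlt : ∀ k l, k < l → ∀ n, a k n = 0 ∨ a l n = 0 := fun k l hkl n => by
    rcases lt_or_ge n (m l) with h | h
    · exact Or.inr (hlow l n h)
    · exact Or.inl (hup k n ((hmono.monotone hkl).trans h))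
  have hdisj : ∀ k l, k ≠ l → ∀ n, a k n = 0 ∨ a l n = 0 := fun k l hkl n =>
    hkl.lt_or_gt.elim (fun h => hlt k l h n) fun h => (hlt l k h n).symm
  have key : ∀ (c : ℕ →₀ ℂ) (T : Finset ℕ),
      ‖ofFinsupp s (∑ k ∈ T, c k • a k)‖ ^ s.toReal = ∑ k ∈ T, ‖c k‖ ^ s.toReal := by
    intro c T
    induction T using Finset.induction_on with
    | empty => simp [Real.zero_rpow hs0.ne']
    | insert k T hk ih =>
      rw [Finset.sum_insert hk, Finset.sum_insert hk, map_add, norm_add_rpow hs, ih, map_smul,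
        norm_smul, hnorm, mul_one]
      intro n
      rw [ofFinsupp_apply, ofFinsupp_apply, Finsupp.finsetSum_apply]
      by_cases h : a k n = 0
      · left; simp [h]
      · right
        refine Finset.sum_eq_zero fun l hl => ?_
        have := (hdisj k l (fun e => hk (e ▸ hl)) n).resolve_left h
        simp [this]
  refine ⟨fun c => ?_, fun M c hc n hn => ?_⟩
  · rw [← Real.rpow_left_inj (norm_nonneg _) (norm_nonneg _) hs0.ne',
      norm_ofFinsupp_rpow hs c, ← key c c.support, Finsupp.linearCombination_apply]
    rfl
  · rw [Finsupp.linearCombination_apply, Finsupp.sum, Finsupp.finsetSum_apply]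
    refine Finset.sum_eq_zero fun k _ => ?_
    rcases lt_or_ge k M with h | h
    · simp [hc k h]
    · simp [hlow k n ((hn.trans_le h).trans_le (hmono.le_apply))]

theorem exists_isBlockMap_tail (hs : s < ∞) (m : ℕ) :
    ∃ β, IsBlockMap s β ∧ ∀ a, ∀ n < m, β a n = 0 := by
  refine ⟨Finsupp.linearCombination ℂ fun k => Finsupp.single (k + m) 1,
    isBlockMap_linearCombination hs (m := fun k => k + m) (fun k => by omega) ?_ ?_
      fun k => norm_ofFinsupp_single _, ?_⟩
  · intro k n hn
    exact Finsupp.single_eq_of_ne (by omega)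
  · intro k n hn
    exact Finsupp.single_eq_of_ne (by omega)
  · intro a n hn
    rw [Finsupp.linearCombination_apply, Finsupp.sum, Finsupp.finsetSum_apply]
    refine Finset.sum_eq_zero fun k _ => ?_
    rw [Finsupp.smul_apply, Finsupp.single_eq_of_ne (by omega), smul_zero]

/-- Perturbations of the unit vectors with summable norms give small operators on `ℓ_s`. -/
theorem norm_linearCombination_le {E : Type*} [SeminormedAddCommGroup E] [NormedSpace ℂ E]
    {y : ℕ → E} {ε : ℝ} (hε : 0 ≤ ε) (hy : ∀ k, ‖y k‖ ≤ ε / 2 / 2 ^ k) (a : ℕ →₀ ℂ) :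
    ‖Finsupp.linearCombination ℂ y a‖ ≤ ε * ‖ofFinsupp s a‖ := by
  rw [Finsupp.linearCombination_apply, Finsupp.sum]
  calc ‖∑ k ∈ a.support, a k • y k‖ ≤ ∑ k ∈ a.support, ‖ofFinsupp s a‖ * (ε / 2 / 2 ^ k) :=
        (norm_sum_le _ _).trans (Finset.sum_le_sum fun k _ => by
          rw [norm_smul]
          exact mul_le_mul (norm_coeff_le a k) (hy k) (norm_nonneg _) (norm_nonneg _))
    _ = ‖ofFinsupp s a‖ * ∑ k ∈ a.support, ε / 2 / 2 ^ k := (Finset.mul_sum _ _ _).symm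
    _ ≤ ‖ofFinsupp s a‖ * ε := by
        gcongr
        exact sum_le_hasSum _ (fun k _ => by positivity) (hasSum_geometric_two' ε)
    _ = _ := mul_comm _ _

/-- If none of finitely many operators is bounded below on any block subspace of `ℓ_s`, then
all of them are small on a common block subspace. -/
theorem exists_isBlockMap_small (hs : s < ∞) {E : Type*} [SeminormedAddCommGroup E]
    [NormedSpace ℂ E] {ι : Type*} (T : Finset ι) (G : ι → (ℕ →₀ ℂ) →ₗ[ℂ] E)
    (hG : ∀ i ∈ T, ∀ β, IsBlockMap s β → ∀ δ > 0, ∃ a, ‖G i (β a)‖ < δ * ‖ofFinsupp s a‖)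
    {ε : ℝ} (hε : 0 < ε) :
    ∃ β, IsBlockMap s β ∧ ∀ i ∈ T, ∀ a, ‖G i (β a)‖ ≤ ε * ‖ofFinsupp s a‖ := by
  classical
  induction T using Finset.induction_on with
  | empty => exact ⟨_, .id, by simp⟩
  | insert i T hi ih =>
    obtain ⟨β, hβ, hβT⟩ := ih fun j hj => hG j (by simp [hj])
    have hstep : ∀ k m : ℕ, ∃ (a : ℕ →₀ ℂ) (m' : ℕ), m < m' ∧ (∀ n < m, a n = 0) ∧
        (∀ n, m' ≤ n → a n = 0) ∧ ‖ofFinsupp s a‖ = 1 ∧ ‖G i (β a)‖ ≤ ε / 2 / 2 ^ k := by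
      intro k m
      -- Composing with a shift keeps the new block to the right of the earlier ones.
      obtain ⟨σ, hσ, hσm⟩ := exists_isBlockMap_tail (s := s) hs m
      obtain ⟨b, hb⟩ := hG i (by simp) _ (hβ.comp hσ) (ε / 2 / 2 ^ k) (by positivity)
      have hb0 : 0 < ‖ofFinsupp s b‖ := by
        refine lt_of_le_of_ne (norm_nonneg _) fun h => ?_
        rw [← h, mul_zero] at hb
        exact absurd hb (norm_nonneg _).not_gt
      set c : ℂ := ((‖ofFinsupp s b‖⁻¹ : ℝ) : ℂ)
      have hc : ‖c‖ = ‖ofFinsupp s b‖⁻¹ := by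
        rw [Complex.norm_real, Real.norm_of_nonneg (inv_nonneg.2 hb0.le)]
      obtain ⟨M, hM⟩ := (σ (c • b)).support.exists_nat_subset_range
      refine ⟨σ (c • b), max (m + 1) M, by omega, hσm _, fun n hn => ?_, ?_, ?_⟩
      · by_contra h
        have := Finset.mem_range.1 (hM (Finsupp.mem_support_iff.2 h))
        omega
      · rw [hσ.norm_map, map_smul, norm_smul, hc, inv_mul_cancel₀ hb0.ne']
      · rw [map_smul, map_smul, map_smul, norm_smul, hc, inv_mul_le_iff₀ hb0, mul_comm]
        exact hb.le
    obtain ⟨a, m, ham⟩ := exists_seq_of_step hstep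
    have hγ : IsBlockMap s (Finsupp.linearCombination ℂ a) :=
      isBlockMap_linearCombination hs (fun k => (ham k).1) (fun k => (ham k).2.1)
        (fun k => (ham k).2.2.1) fun k => (ham k).2.2.2.1
    refine ⟨_, hβ.comp hγ, fun j hj c => ?_⟩
    rcases Finset.mem_insert.1 hj with rfl | hj
    · have h1 : G j ((β ∘ₗ Finsupp.linearCombination ℂ a) c)
          = Finsupp.linearCombination ℂ (fun k => G j (β (a k))) c := by
        simp [Finsupp.linearCombination_apply, Finsupp.sum, map_sum]
      rw [h1]
      exact norm_linearCombination_le hε.le (fun k => (ham k).2.2.2.2) c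
    · refine (hβT j hj _).trans (le_of_eq ?_)
      rw [hγ.norm_map]

end

/-! ### The exponents `r_A` -/

theorem rExponent_lt_top {N : ℕ} {p : Fin N → ℝ≥0∞} (hp : ∀ i, p i < ∞)
    {A : Finset (Fin N)} (hA : A.Nonempty) :
    rExponent p A < ∞ := by
  obtain ⟨i, hi⟩ := hA
  rw [rExponent, ENNReal.inv_lt_top]
  refine lt_min zero_lt_one (lt_of_lt_of_le ?_ (Finset.single_le_sum (fun _ _ => zero_le) hi))
  exact ENNReal.inv_pos.2 (hp i).ne

theorem one_le_rExponent {N : ℕ} (p : Fin N → ℝ≥0∞) (A : Finset (Fin N)) : 1 ≤ rExponent p A :=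
  ENNReal.one_le_inv.2 (min_le_left _ _)

theorem one_le_rExponent_toReal {N : ℕ} {p : Fin N → ℝ≥0∞} (hp : ∀ i, p i < ∞)
    {A : Finset (Fin N)} (hA : A.Nonempty) :
    1 ≤ (rExponent p A).toReal :=
  have : Fact (1 ≤ rExponent p A) := ⟨one_le_rExponent p A⟩
  one_le_toReal _ (rExponent_lt_top hp hA)

section

variable {N : ℕ} {p : Fin N → ℝ≥0∞} [∀ i, Fact (1 ≤ p i)]

theorem rExponent_toReal_inv (A : Finset (Fin N)) :
    (rExponent p A).toReal⁻¹ = min 1 (∑ i ∈ A, (p i).toReal⁻¹) := by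
  have hfin : ∀ i ∈ A, (p i)⁻¹ ≠ ∞ := fun i _ =>
    ENNReal.inv_ne_top.2 (zero_lt_one.trans_le Fact.out).ne'
  rw [rExponent, ENNReal.toReal_inv, inv_inv, ENNReal.toReal_min ENNReal.one_ne_top
    (ENNReal.sum_ne_top.2 hfin), ENNReal.toReal_sum hfin]
  simp [ENNReal.toReal_inv]

theorem rExponent_toReal_inv_le (A : Finset (Fin N)) :
    (rExponent p A).toReal⁻¹ ≤ ∑ i ∈ A, (p i).toReal⁻¹ :=
  (rExponent_toReal_inv A).le.trans (min_le_right _ _)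

theorem rExponent_toReal_eq_one_or (A : Finset (Fin N)) :
    (rExponent p A).toReal = 1 ∨
      (rExponent p A).toReal⁻¹ = ∑ i ∈ A, (p i).toReal⁻¹ := by
  have h := rExponent_toReal_inv (p := p) A
  rcases min_choice 1 (∑ i ∈ A, (p i).toReal⁻¹) with h' | h' <;> rw [h'] at h
  · exact Or.inl (by simpa using h)
  · exact Or.inr h

theorem le_of_forall_mul_rpow_le {a b x y : ℝ} (ha : 0 < a)
    (h : ∀ K : ℕ, 1 ≤ K → a * (K : ℝ) ^ x ≤ b * (K : ℝ) ^ y) : x ≤ y := by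
  by_contra! hxy
  have ht : Filter.Tendsto (fun K : ℕ => (K : ℝ) ^ (x - y)) Filter.atTop Filter.atTop :=
    (tendsto_rpow_atTop (sub_pos.2 hxy)).comp tendsto_natCast_atTop_atTop
  obtain ⟨K, hK, hK1⟩ := ((ht.eventually_gt_atTop (b / a)).and
    (Filter.eventually_ge_atTop 1)).exists
  have hK0 : (0 : ℝ) < K := by exact_mod_cast hK1
  rw [Real.rpow_sub hK0, div_lt_div_iff₀ ha (Real.rpow_pos_of_pos hK0 y)] at hK
  have := h K hK1
  linarith

/-! ### Copies of `ℓ_s` in the projective tensor product -/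

theorem exists_rect_slab_empty_eq_smul (f : Fin N → ℕ) (J : Set ℕ) :
    ∃ t : ⨂[ℂ] i, Ell (p i), ∀ v, ∃ z : ℂ, rect p (slab ∅ f J) v = z • t := by
  refine ⟨PiTensorProduct.tprod ℂ fun i => lp.single (p i) (f i) (1 : ℂ), fun v => ?_⟩
  induction v using PiTensorProduct.induction_on with
  | smul_tprod c x =>
    rw [map_smul, rect_slab_tprod, smul_smul]
    exact ⟨_, by simp; rfl⟩
  | add v w hv hw =>
    obtain ⟨a, ha⟩ := hv
    obtain ⟨b, hb⟩ := hw
    exact ⟨a + b, by rw [map_add, ha, hb, add_smul]⟩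

/-- Gliding hump in the case that no slice `n_j = l`, `j ∈ A`, preserves a block subspace of
`ℓ_s`: suitable normalized blocks are then sent close to diagonal blocks, which behave like the
unit vectors of `ℓ_r`, `r = r_A`; comparing the norms of sums of `K` blocks gives `s = r`. -/
theorem eq_rExponent_of_slices_small (hp : ∀ i, p i < ∞) {s : ℝ≥0∞} [Fact (1 ≤ s)]
    (hs : s < ∞) {A : Finset (Fin N)} (hA : A.Nonempty) {f : Fin N → ℕ}
    {U : (ℕ →₀ ℂ) →ₗ[ℂ] (⨂[ℂ] i, Ell (p i))} {c C : ℝ} (hc : 0 < c)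
    (hlow : ∀ a, c * ‖ofFinsupp s a‖ ≤ ‖U a‖) (hup : ∀ a, ‖U a‖ ≤ C * ‖ofFinsupp s a‖)
    (hfin : ∀ a, IsFinite (U a)) (hslab : ∀ a, rect p (slab A f Set.univ) (U a) = U a)
    (hsmall : ∀ j ∈ A, ∀ l : ℕ, ∀ β, IsBlockMap s β → ∀ δ > 0, ∃ a,
      ‖rect p (Function.update (fun _ => Set.univ) j {l}) (U (β a))‖ < δ * ‖ofFinsupp s a‖) :
    s = rExponent p A := by
  have hs0 := toReal_pos s hs
  set Q : ℕ → (⨂[ℂ] i, Ell (p i)) →L[ℂ] (⨂[ℂ] i, Ell (p i)) := fun m =>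
    rect p fun i => if i ∈ A then Set.Ici m else Set.univ
  have hstep : ∀ k m : ℕ, ∃ (a : ℕ →₀ ℂ) (m' : ℕ), m < m' ∧ (∀ n < m, a n = 0) ∧
      (∀ n, m' ≤ n → a n = 0) ∧ ‖ofFinsupp s a‖ = 1 ∧
      rect p (fun _ => Set.Iio m') (U a) = U a ∧ ‖U a - Q m (U a)‖ ≤ c / 2 / 2 / 2 ^ k := by
    intro k m
    -- The allowed error is shared among the `A.card * m` slices cut off below level `m`.
    set ε : ℝ := c / 2 / 2 / 2 ^ k / (A.card * m + 1)
    have hε : 0 < ε := by positivity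
    obtain ⟨β, hβ, hβG⟩ := exists_isBlockMap_small (s := s) hs (A ×ˢ Finset.range m)
      (fun jl => (rect p (Function.update (fun _ => Set.univ) jl.1 {jl.2})).toLinearMap ∘ₗ U)
      (fun jl hjl => hsmall jl.1 (Finset.mem_product.1 hjl).1 jl.2) hε
    set a := β (Finsupp.single m 1)
    have ha1 : ‖ofFinsupp s a‖ = 1 := by rw [hβ.norm_map, norm_ofFinsupp_single]
    obtain ⟨M, hM⟩ := a.support.exists_nat_subset_range
    obtain ⟨M', hM'⟩ := hfin a
    refine ⟨a, max (m + 1) (max M M'), by omega,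
      hβ.tail_map m _ fun n hn => Finsupp.single_eq_of_ne (by omega), fun n hn => ?_, ha1,
      hM' _ (by omega), ?_⟩
    · by_contra h
      have := Finset.mem_range.1 (hM (Finsupp.mem_support_iff.2 h))
      omega
    · refine (norm_sub_rect_tail_le A m (U a)).trans ?_
      calc ∑ j ∈ A, ∑ l ∈ Finset.range m,
            ‖rect p (Function.update (fun _ => Set.univ) j {l}) (U a)‖
          ≤ ∑ j ∈ A, ∑ l ∈ Finset.range m, ε :=
            Finset.sum_le_sum fun j hj => Finset.sum_le_sum fun l hl => by
              have := hβG (j, l) (Finset.mem_product.2 ⟨hj, hl⟩) (Finsupp.single m 1)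
              rw [norm_ofFinsupp_single, mul_one] at this
              exact this
        _ = (A.card * m) * ε := by simp [mul_assoc]
        _ ≤ (A.card * m + 1) * ε := by linarith
        _ = c / 2 / 2 / 2 ^ k := mul_div_cancel₀ _ (by positivity)
  obtain ⟨a, m, ham⟩ := exists_seq_of_step hstep
  have hγ : IsBlockMap s (Finsupp.linearCombination ℂ a) :=
    isBlockMap_linearCombination hs (fun k => (ham k).1) (fun k => (ham k).2.1)
      (fun k => (ham k).2.2.1) fun k => (ham k).2.2.2.1
  set w : ℕ → ⨂[ℂ] i, Ell (p i) := fun k => Q (m k) (U (a k))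
  set y : ℕ → ⨂[ℂ] i, Ell (p i) := fun k => U (a k) - w k
  have hy : ∀ k, ‖y k‖ ≤ c / 2 / 2 / 2 ^ k := fun k => (ham k).2.2.2.2.2
  set I : ℕ → Set ℕ := fun k => Set.Ico (m k) (m (k + 1))
  have hmono : Monotone m := monotone_nat_of_le_succ fun k => (ham k).1.le
  have hI : ∀ T : Finset ℕ, (T : Set ℕ).PairwiseDisjoint I := fun T k _ l _ hkl =>
    hmono.pairwise_disjoint_on_Ico_succ hkl
  have hw : ∀ k, rect p (slab A f (I k)) (w k) = w k := by
    intro k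
    have h1 : w k = rect p (fun i => (if i ∈ A then Set.Ici (m k) else Set.univ) ∩
        (slab A f Set.univ i ∩ Set.Iio (m (k + 1)))) (U (a k)) := by
      rw [← rect_rect, ← rect_rect, (ham k).2.2.2.2.1, hslab]
    rw [h1]
    refine rect_rect_of_subset ?_ _
    intro i n hn
    by_cases hi : i ∈ A
    · simpa [slab, hi, I] using hn
    · exact (by simpa [slab, hi] using hn : n = f i ∧ _).1 ▸ by simp [slab, hi]
  have hwlow : ∀ k, c / 2 ≤ ‖w k‖ ∧ ‖w k‖ ≤ C + c / 2 := by
    intro k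
    have h1 := hlow (a k)
    have h2 := hup (a k)
    rw [(ham k).2.2.2.1, mul_one] at h1 h2
    have h3 : ‖y k‖ ≤ c / 2 := (hy k).trans (by
      rw [div_div]
      exact div_le_self (by positivity) (by
        have : (1 : ℝ) ≤ 2 ^ k := one_le_pow₀ (by norm_num)
        linarith))
    have h4 : ‖U (a k)‖ ≤ ‖y k‖ + ‖w k‖ := by
      have := norm_add_le (y k) (w k)
      rwa [sub_add_cancel] at this
    have h5 : ‖w k‖ ≤ ‖U (a k)‖ := norm_rect_apply_le _ _
    constructor <;> linarith
  have hC : 0 < C + c / 2 := lt_of_lt_of_le (by positivity) ((hwlow 0).1.trans (hwlow 0).2)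
  set r := (rExponent p A).toReal
  have hr : 1 ≤ r := one_le_rExponent_toReal hp hA
  have hr0 : 0 < r := zero_lt_one.trans_le hr
  have hsum : ∀ K : ℕ, c / 2 * (K : ℝ) ^ s.toReal⁻¹ ≤ ‖∑ k ∈ Finset.range K, w k‖ ∧
      ‖∑ k ∈ Finset.range K, w k‖ ≤ (C + c / 2) * (K : ℝ) ^ s.toReal⁻¹ := by
    intro K
    set e : ℕ →₀ ℂ := ∑ k ∈ Finset.range K, Finsupp.single k 1
    have he : ‖ofFinsupp s e‖ = (K : ℝ) ^ s.toReal⁻¹ := by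
      have h1 := lp.norm_sum_single (E := fun _ : ℕ => ℂ) hs0 (fun _ => 1) (Finset.range K)
      have h2 : ofFinsupp s e = ∑ k ∈ Finset.range K, lp.single s k (1 : ℂ) := by
        simp only [e, map_sum, ofFinsupp_single, one_smul]
      rw [← h2] at h1
      rw [← Real.rpow_rpow_inv (norm_nonneg (ofFinsupp s e)) hs0.ne', h1]
      simp
    have hlin : ∀ z : ℕ → ⨂[ℂ] i, Ell (p i),
        Finsupp.linearCombination ℂ z e = ∑ k ∈ Finset.range K, z k := by
      intro z
      simp [e, map_sum]
    set b := Finsupp.linearCombination ℂ a e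
    have hb : ‖ofFinsupp s b‖ = (K : ℝ) ^ s.toReal⁻¹ := (hγ.norm_map e).trans he
    have hUb : U b = ∑ k ∈ Finset.range K, y k + ∑ k ∈ Finset.range K, w k := by
      rw [← Finset.sum_add_distrib]
      simp [b, e, map_sum, y]
    have hyb : ‖∑ k ∈ Finset.range K, y k‖ ≤ c / 2 * (K : ℝ) ^ s.toReal⁻¹ := by
      rw [← hlin, ← he]
      exact norm_linearCombination_le (by positivity) hy e
    have h1 := hlow b
    have h2 := hup b
    rw [hb] at h1 h2
    have h3 : ‖U b‖ ≤ ‖∑ k ∈ Finset.range K, y k‖ + ‖∑ k ∈ Finset.range K, w k‖ := by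
      rw [hUb]
      exact norm_add_le _ _
    have h4 : ‖∑ k ∈ Finset.range K, w k‖ ≤ ‖U b‖ + ‖∑ k ∈ Finset.range K, y k‖ := by
      have := norm_sub_le (U b) (∑ k ∈ Finset.range K, y k)
      rwa [hUb, add_sub_cancel_left, ← hUb] at this
    constructor <;> linarith
  have hle : r⁻¹ ≤ s.toReal⁻¹ := by
    refine le_of_forall_mul_rpow_le (a := c / 2) (b := C + c / 2) (by positivity) fun K _ => ?_
    refine le_trans ?_ (hsum K).2
    rw [← Real.rpow_le_rpow_iff (by positivity) (norm_nonneg _) hr0]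
    refine le_trans ?_ (sum_norm_rpow_le_of_slab hp hA hr (rExponent_toReal_inv_le A) f
      (Finset.range K) I (hI _) w fun k _ => hw k)
    rw [Real.mul_rpow (by positivity) (by positivity), Real.rpow_inv_rpow (by positivity) hr0.ne']
    calc (c / 2) ^ r * K = ∑ k ∈ Finset.range K, (c / 2) ^ r := by simp [mul_comm]
      _ ≤ _ := Finset.sum_le_sum fun k _ =>
        Real.rpow_le_rpow (by positivity) (hwlow k).1 hr0.le
  have hge : s.toReal⁻¹ ≤ r⁻¹ := by
    refine le_of_forall_mul_rpow_le (a := c / 2) (b := 2 * (C + c / 2)) (by positivity)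
      fun K _ => ?_
    refine (hsum K).1.trans ((norm_sum_le_of_slab hp hA hr (rExponent_toReal_eq_one_or A) f
      (Finset.range K) I (hI _) w fun k _ => hw k).trans ?_)
    rw [mul_assoc]
    gcongr
    calc (∑ k ∈ Finset.range K, ‖w k‖ ^ r) ^ r⁻¹
        ≤ (∑ k ∈ Finset.range K, (C + c / 2) ^ r) ^ r⁻¹ :=
          Real.rpow_le_rpow (Finset.sum_nonneg fun k _ => by positivity)
            (Finset.sum_le_sum fun k _ => Real.rpow_le_rpow (norm_nonneg _) (hwlow k).2 hr0.le)
            (inv_nonneg.2 hr0.le)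
      _ = (C + c / 2) * (K : ℝ) ^ r⁻¹ := by
          rw [Finset.sum_const, Finset.card_range, nsmul_eq_mul, mul_comm,
            Real.mul_rpow (by positivity) (by positivity), Real.rpow_rpow_inv hC.le hr0.ne']
  exact (ENNReal.toReal_eq_toReal_iff' hs.ne (rExponent_lt_top hp hA).ne).1
    (inv_injective (le_antisymm hge hle))

/-- Either the hypotheses of `eq_rExponent_of_slices_small` hold, or some slice maps a block
subspace of `ℓ_s` isomorphically into a slab with one free direction less. -/
theorem exists_eq_rExponent (hp : ∀ i, p i < ∞) {s : ℝ≥0∞} [Fact (1 ≤ s)]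
    (hs : s < ∞) (A : Finset (Fin N)) (f : Fin N → ℕ)
    (U : (ℕ →₀ ℂ) →ₗ[ℂ] (⨂[ℂ] i, Ell (p i))) {c C : ℝ} (hc : 0 < c)
    (hlow : ∀ a, c * ‖ofFinsupp s a‖ ≤ ‖U a‖) (hup : ∀ a, ‖U a‖ ≤ C * ‖ofFinsupp s a‖)
    (hfin : ∀ a, IsFinite (U a)) (hslab : ∀ a, rect p (slab A f Set.univ) (U a) = U a) :
    ∃ A' : Finset (Fin N), A'.Nonempty ∧ s = rExponent p A' := by
  induction A using Finset.strongInduction generalizing f U c with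
  | H A ih =>
    rcases A.eq_empty_or_nonempty with rfl | hA
    · -- The range of `U` lies in a line, but `U` is injective.
      exfalso
      obtain ⟨t, ht⟩ := exists_rect_slab_empty_eq_smul (p := p) f Set.univ
      choose z hz using ht
      have hU : ∀ a, U a = z (U a) • t := fun a => by rw [← hz, hslab]
      have hinj : ∀ a, U a = 0 → a = 0 := fun a ha => by
        have h1 := hlow a
        rw [ha, norm_zero] at h1
        have h2 : ‖ofFinsupp s a‖ = 0 :=
          le_antisymm (by nlinarith [norm_nonneg (ofFinsupp s a)]) (norm_nonneg _)
        exact ofFinsupp_injective ((norm_eq_zero.1 h2).trans (map_zero _).symm)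
      set e₀ : ℕ →₀ ℂ := Finsupp.single 0 1
      set e₁ : ℕ →₀ ℂ := Finsupp.single 1 1
      have h := hinj (z (U e₁) • e₀ - z (U e₀) • e₁) (by
        rw [map_sub, map_smul, map_smul, sub_eq_zero]
        calc z (U e₁) • U e₀ = z (U e₁) • z (U e₀) • t := by rw [← hU]
          _ = z (U e₀) • z (U e₁) • t := smul_comm _ _ _
          _ = z (U e₀) • U e₁ := by rw [← hU])
      have h0 : z (U e₀) = 0 := by
        have := DFunLike.congr_fun h 1
        simpa [e₀, e₁] using this
      have h1 := hinj e₀ (by rw [hU, h0, zero_smul])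
      simp [e₀] at h1
    by_cases hsmall : ∀ j ∈ A, ∀ l : ℕ, ∀ β, IsBlockMap s β → ∀ δ > 0, ∃ a,
      ‖rect p (Function.update (fun _ => Set.univ) j {l}) (U (β a))‖ < δ * ‖ofFinsupp s a‖
    · exact ⟨A, hA, eq_rExponent_of_slices_small hp hs hA hc hlow hup hfin hslab hsmall⟩
    push Not at hsmall
    obtain ⟨j, hj, l, β, hβ, δ, hδ, hδU⟩ := hsmall
    refine ih (A.erase j) (Finset.erase_ssubset hj) (Function.update f j l)
      ((rect p (Function.update (fun _ => Set.univ) j {l})).toLinearMap ∘ₗ U ∘ₗ β) hδ hδU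
      (fun a => ?_) (fun a => (hfin _).rect _) fun a => ?_
    · refine (norm_rect_apply_le _ _).trans ((hup _).trans (le_of_eq ?_))
      rw [hβ.norm_map]
    · change rect p _ (rect p _ (U (β a))) = rect p _ (U (β a))
      rw [← hslab (β a), rect_rect (Function.update _ j {l}), rect_rect_of_subset]
      intro i n hn
      rcases eq_or_ne i j with rfl | hij
      · simpa [slab, hj] using hn
      · by_cases hi : i ∈ A
        · simp [slab, hij, hi]
        · simpa [slab, hij, hi] using hn

end

section

variable {N : ℕ} {p : Fin N → ℝ≥0∞} [∀ i, Fact (1 ≤ p i)]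

/-- The "only if" half: after a small perturbation the images of the unit vectors have finitely
many nonzero coefficients, and `exists_eq_rExponent` applies to the full tensor product. -/
theorem exists_eq_rExponent_of_embeds (hp : ∀ i, p i < ∞) {s : ℝ≥0∞} [Fact (1 ≤ s)]
    (hs : s < ∞) (h : EmbedsIsomorphically (Ell s) (ProjectiveTensorEll p)) :
    ∃ A : Finset (Fin N), A.Nonempty ∧ s = rExponent p A := by
  obtain ⟨T, c, hc, hT⟩ := h
  have happrox : ∀ k : ℕ, ∃ v : ⨂[ℂ] i, Ell (p i), IsFinite v ∧
      ‖(v : ProjectiveTensorEll p) - T (lp.single s k (1 : ℂ))‖ ≤ c / 2 / 2 / 2 ^ k := by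
    intro k
    set ε : ℝ := c / 2 / 2 / 2 ^ k / 2
    have hε : 0 < ε := by positivity
    obtain ⟨v, hv⟩ := UniformSpace.Completion.denseRange_coe.exists_dist_lt
      (T (lp.single s k (1 : ℂ))) hε
    obtain ⟨m, hm⟩ := (Metric.tendsto_atTop.1 (tendsto_rect_Iio hp v) ε hε)
    refine ⟨rect p (fun _ => Set.Iio m) v, isFinite_rect_Iio m v, ?_⟩
    have h1 := hm m le_rfl
    rw [← UniformSpace.Completion.dist_eq] at h1
    rw [← dist_eq_norm]
    calc _ ≤ dist ((rect p (fun _ => Set.Iio m) v : ⨂[ℂ] i, Ell (p i)) : ProjectiveTensorEll p) v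
          + dist (v : ProjectiveTensorEll p) (T (lp.single s k (1 : ℂ))) := dist_triangle _ _ _
      _ ≤ ε + ε := by
          rw [dist_comm] at hv
          exact add_le_add h1.le hv.le
      _ = _ := add_halves _
  choose y hyfin hy using happrox
  set U := Finsupp.linearCombination ℂ y
  have hclose : ∀ a, ‖((U a : ⨂[ℂ] i, Ell (p i)) : ProjectiveTensorEll p) - T (ofFinsupp s a)‖
      ≤ c / 2 * ‖ofFinsupp s a‖ := by
    intro a
    have h1 : ((U a : ⨂[ℂ] i, Ell (p i)) : ProjectiveTensorEll p) - T (ofFinsupp s a)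
        = Finsupp.linearCombination ℂ (fun k => (y k : ProjectiveTensorEll p)
            - T (lp.single s k (1 : ℂ))) a := by
      rw [← UniformSpace.Completion.coe_toComplL (𝕜 := ℂ)]
      simp only [U, ofFinsupp, Finsupp.linearCombination_apply, Finsupp.sum, map_sum, map_smul,
        smul_sub, Finset.sum_sub_distrib]
    rw [h1]
    exact norm_linearCombination_le (by positivity) hy a
  have hslab : ∀ a, rect p (slab Finset.univ (fun _ => 0) Set.univ) (U a) = U a := fun a => by
    have : slab (Finset.univ : Finset (Fin N)) (fun _ => 0) Set.univ = fun _ => Set.univ := by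
      funext i
      simp [slab]
    rw [this, rect_univ]
  refine exists_eq_rExponent hp hs Finset.univ (fun _ => 0) U (c := c / 2) (C := ‖T‖ + c / 2)
    (by positivity) (fun a => ?_) (fun a => ?_) (fun a => isFinite_linearCombination hyfin a) hslab
  · have h1 := hT (ofFinsupp s a)
    have h2 := norm_sub_norm_le (T (ofFinsupp s a)) (U a : ProjectiveTensorEll p)
    rw [norm_sub_rev, UniformSpace.Completion.norm_coe] at h2
    have h3 := hclose a
    linarith
  · have h1 := T.le_opNorm (ofFinsupp s a)
    have h2 := norm_sub_norm_le (U a : ProjectiveTensorEll p) (T (ofFinsupp s a))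
    rw [UniformSpace.Completion.norm_coe] at h2
    have h3 := hclose a
    linarith

theorem norm_tprod (x : ∀ i, Ell (p i)) : ‖PiTensorProduct.tprod ℂ x‖ = ∏ i, ‖x i‖ := by
  refine le_antisymm (PiTensorProduct.projectiveSeminorm_tprod_le x) ?_
  choose g hg hgx using fun i => exists_dual_vector'' ℂ (x i)
  set F : ContinuousMultilinearMap ℂ (fun i => Ell (p i)) ℂ :=
    (ContinuousMultilinearMap.mkPiAlgebra ℂ (Fin N) ℂ).compContinuousLinearMap g
  have hF : ‖F‖ ≤ 1 := by
    refine ContinuousMultilinearMap.opNorm_le_bound zero_le_one fun z => ?_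
    rw [one_mul]
    simp only [F, ContinuousMultilinearMap.compContinuousLinearMap_apply,
      ContinuousMultilinearMap.mkPiAlgebra_apply, norm_prod]
    exact Finset.prod_le_prod (fun _ _ => norm_nonneg _) fun i _ => by
      simpa using (g i).le_of_opNorm_le (hg i) (z i)
  have h := PiTensorProduct.norm_eval_le_projectiveSeminorm F (PiTensorProduct.tprod ℂ x)
  have hval : PiTensorProduct.lift F.toMultilinearMap (PiTensorProduct.tprod ℂ x)
      = ((∏ i, ‖x i‖ : ℝ) : ℂ) := by
    rw [PiTensorProduct.lift.tprod, Complex.ofReal_prod]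
    change F x = _
    simp only [F, ContinuousMultilinearMap.compContinuousLinearMap_apply,
      ContinuousMultilinearMap.mkPiAlgebra_apply]
    change F x = _
    simp only [F, ContinuousMultilinearMap.compContinuousLinearMap_apply,
      ContinuousMultilinearMap.mkPiAlgebra_apply]
    change F x = _
    simp only [F, ContinuousMultilinearMap.compContinuousLinearMap_apply,
      ContinuousMultilinearMap.mkPiAlgebra_apply]
    exact Finset.prod_congr rfl fun i _ => hgx i
  rw [hval, Complex.norm_real, Real.norm_of_nonneg (by positivity)] at h
  exact h.trans (mul_le_of_le_one_left (norm_nonneg _) hF)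

theorem embedsIsomorphically_of_finsupp {s : ℝ≥0∞} [Fact (1 ≤ s)] (hs : s < ∞)
    (U : (ℕ →₀ ℂ) →ₗ[ℂ] (⨂[ℂ] i, Ell (p i))) {c C : ℝ} (hc : 0 < c)
    (hlow : ∀ a, c * ‖ofFinsupp s a‖ ≤ ‖U a‖) (hup : ∀ a, ‖U a‖ ≤ C * ‖ofFinsupp s a‖) :
    EmbedsIsomorphically (Ell s) (ProjectiveTensorEll p) := by
  set V : (ℕ →₀ ℂ) →ₗ[ℂ] ProjectiveTensorEll p :=
    (UniformSpace.Completion.toComplL (𝕜 := ℂ) (E := ⨂[ℂ] i, Ell (p i))).toLinearMap ∘ₗ U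
  have hV : ∀ a, ‖V a‖ = ‖U a‖ := fun a => UniformSpace.Completion.norm_coe (U a)
  have hd := denseRange_ofFinsupp (q := s) hs
  have hVup : ∀ a, ‖V a‖ ≤ C * ‖ofFinsupp s a‖ := fun a => (hV a).trans_le (hup a)
  refine ⟨V.extendOfNorm (ofFinsupp s), c, hc, fun x => ?_⟩
  refine hd.induction_on (p := fun x => c * ‖x‖ ≤ ‖V.extendOfNorm (ofFinsupp s) x‖) x
    (isClosed_le (by fun_prop) (by fun_prop)) fun a => ?_
  rw [LinearMap.extendOfNorm_eq hd ⟨C, hVup⟩, hV]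
  exact hlow a

/-- The "if" half: the diagonal tensors, with the factors outside `A` fixed, span `ℓ_r` for
`r = r_A`. -/
theorem embeds_rExponent (hp : ∀ i, p i < ∞) {s : ℝ≥0∞} [Fact (1 ≤ s)] {A : Finset (Fin N)}
    (hA : A.Nonempty) (hsA : s = rExponent p A) :
    EmbedsIsomorphically (Ell s) (ProjectiveTensorEll p) := by
  have hs : s < ∞ := hsA ▸ rExponent_lt_top hp hA
  have hs0 := toReal_pos s hs
  have hs1 := one_le_toReal s hs
  set d : ℕ → ∀ i, Ell (p i) := fun k => A.piecewise
    (fun i => lp.single (p i) k (1 : ℂ)) fun i => lp.single (p i) 0 (1 : ℂ)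
  set y : ℕ → ⨂[ℂ] i, Ell (p i) := fun k => PiTensorProduct.tprod ℂ (d k)
  have hd : ∀ k i, d k i = lp.single (p i) (if i ∈ A then k else 0) (1 : ℂ) := by
    intro k i
    by_cases hi : i ∈ A <;> simp [d, hi]
  have hy1 : ∀ k, ‖y k‖ = 1 := fun k => by
    rw [norm_tprod]
    refine Finset.prod_eq_one fun i _ => ?_
    rw [hd, lp.norm_single (zero_lt_one.trans_le (Fact.out : 1 ≤ p i)), norm_one]
  have hslab : ∀ k, rect p (slab A (fun _ => 0) {k}) (y k) = y k := by
    intro k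
    rw [rect_tprod]
    congr 1
    funext i
    have h1 : slab A (fun _ => 0) {k} i = {if i ∈ A then k else 0} := by
      by_cases hi : i ∈ A <;> simp [slab, hi]
    rw [h1, hd, restrictL_singleton]
    simp
  have hnorm : ∀ a : ℕ →₀ ℂ, ∑ k ∈ a.support, ‖a k • y k‖ ^ s.toReal
      = ‖ofFinsupp s a‖ ^ s.toReal := by
    intro a
    rw [norm_ofFinsupp_rpow hs]
    simp [norm_smul, hy1]
  have hI : ∀ a : ℕ →₀ ℂ, (a.support : Set ℕ).PairwiseDisjoint fun k => ({k} : Set ℕ) :=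
    fun a k _ l _ hkl => Set.disjoint_singleton.2 hkl
  refine embedsIsomorphically_of_finsupp hs (Finsupp.linearCombination ℂ y) (c := 1) (C := 2)
    one_pos (fun a => ?_) fun a => ?_
  · rw [one_mul, ← Real.rpow_le_rpow_iff (norm_nonneg _) (norm_nonneg _) hs0, ← hnorm]
    exact sum_norm_rpow_le_of_slab hp hA hs1 (hsA ▸ rExponent_toReal_inv_le A) (fun _ => 0)
      a.support (fun k => {k}) (hI a) (fun k => a k • y k)
      fun k _ => by rw [map_smul, hslab]
  · rw [← Real.rpow_rpow_inv (norm_nonneg (ofFinsupp s a)) hs0.ne', ← hnorm]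
    exact norm_sum_le_of_slab hp hA hs1 (hsA ▸ rExponent_toReal_eq_one_or A) (fun _ => 0)
      a.support (fun k => {k}) (hI a) (fun k => a k • y k)
      fun k _ => by rw [map_smul, hslab]

end

end EllTensor

theorem theorem4p1 {N : ℕ} (p : Fin N → ℝ≥0∞) [∀ i, Fact (1 ≤ p i)]
    (hp_one : ∀ i, 1 < p i) (hp_top : ∀ i, p i < ∞)
    (s : ℝ≥0∞) [Fact (1 ≤ s)] (hs_top : s < ∞) :
    EmbedsIsomorphically (Ell s) (ProjectiveTensorEll p) ↔
      ∃ A : Finset (Fin N), A.Nonempty ∧ s = rExponent p A :=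
  ⟨EllTensor.exists_eq_rExponent_of_embeds hp_top hs_top,
    fun ⟨_, hA, hsA⟩ => EllTensor.embeds_rExponent hp_top hA hsA⟩
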